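/- **Setting.** Let $(Z,d)$ be a complete metric space with at least two points, $b\in Z$, and write $B(x,r)=\{y: d(x,y)<r\}$ (so $B(x,0)=\emptyset$) and $|x|=d(x,b)$. Let $\nu$ be a (complete) Borel regular measure on $Z$ that is doubling with constant $C_\nu>1$, i.e. $0<\nu(B(x,2r))\le C_\nu\,\nu(B(x,r))<\infty$ for all $x\in Z$, $r>0$. Let $m_0\in\{0,1\}$ and assume that $Z$ is uniformly perfect at $b$ for radii $r\ge m_0$ with constant $\kappa>1$, i.e. $B(b,\kappa r)\setminus B(b,r)\neq\emptyset$ whenever $B(b,r)\ne Z$ and $0\neq r\ge m_0$. Let $\sigma>0$ and $$\rho(t)=\frac{1}{(t+m_0)\,\nu(B(b,t+m_0))^{1/\sigma}},\quad t\ge 0\qquad(\rho(0)=\infty\text{ if }m_0=0),\qquad \rho(x):=\rho(|x|).$$ Let $Z'=Z$ if $m_0=1$ and $Z'=Z\setminus\{b\}$ if $m_0=0$, and equip $Z'$ with the metric $$\hat d(x,y)=\inf\sum_{j=1}^n(\rho(x_j)+\rho(x_{j-1}))\,d(x_j,x_{j-1}),$$ where the infimum is over all finite chains $x=x_0,x_1,\dots,x_n=y$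 in $Z$. Let $(\widehat Z,\hat d)$ be the completion of $(Z',\hat d)$, and let $\hat\nu$ be the measure given by $d\hat\nu=\rho^\sigma\,d\nu$ on $Z'$ and $\hat\nu(\widehat Z\setminus Z')=0$. **Theorem.** (i) $\hat\nu$ is doubling on $(Z',\hat d)$ and on $(\widehat Z,\hat d)$, with a doubling constant that depends only on $C_\nu$, $\kappa$ and $\sigma$. (ii) There is a constant $A$, depending only on $C_\nu$, $\kappa$ and $\sigma$, such that the following holds. Let $1\le p<\infty$ and $\theta>0$ with $\sigma=p\theta$. For every $\nu$-measurable function $u:Z\to[-\infty,\infty]$ that is finite $\nu$-a.e., let $$E(u)=\int_Z\int_Z\frac{|u(x)-u(y)|^p}{d(x,y)^{\theta p}}\,\frac{d\nu(y)\,d\nu(x)}{\nu(B(x,d(x,y)))}\in[0,\infty],$$ where the integrand is interpreted as $0$ when $x=y$, and let $\widehat E(u)$ be the corresponding energy with respect to $(\widehat Z,\hat d,\hat\nu)$, where $u|_{Z'}$ is extended arbitrarily to the $\hat\nu$-null set $\widehat Z\setminus Z'$. Then $E(u)\le A\,\widehat E(u)$ and $\widehat E(u)\le A\,E(u)$. 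-/

import Mathlib

open MeasureTheory Metric
open scoped NNReal ENNReal

/-- A measure `μ` on a metric space is doubling with doubling constant `C > 1`. -/
structure IsDoublingWith {X : Type*} [PseudoMetricSpace X] [MeasurableSpace X]
    (μ : Measure X) (C : ℝ≥0) : Prop where
  one_lt : 1 < C
  pos : ∀ (x : X) (r : ℝ), 0 < r → 0 < μ (ball x (2 * r))
  doubling : ∀ (x : X) (r : ℝ), 0 < r → μ (ball x (2 * r)) ≤ C * μ (ball x r)
  finite : ∀ (x : X) (r : ℝ), 0 < r → μ (ball x r) < ⊤

/-- `X` is uniformly perfect at `b` for radii `r ≥ m₀`, with constant `κ > 1`. -/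
structure UniformlyPerfectAt {X : Type*} [PseudoMetricSpace X] (b : X) (m₀ κ : ℝ) : Prop where
  one_lt : 1 < κ
  nonempty : ∀ r : ℝ, r ≠ 0 → m₀ ≤ r → ball b r ≠ Set.univ → (ball b (κ * r) \ ball b r).Nonempty

/-- The Besov (fractional Sobolev) energy `[u]_{θ,p}^p` of an extended real valued function.
The integrand is interpreted as `0` on the diagonal, that is, the inner integral is
taken over `y ≠ x`. -/
noncomputable def besovEnergy {X : Type*} [MetricSpace X] [MeasurableSpace X]
    (μ : Measure X) (θ p : ℝ) (u : X → EReal) : ℝ≥0∞ :=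
  ∫⁻ x, ∫⁻ y in {x}ᶜ,
    (u x - u y).abs ^ p / (edist x y ^ (θ * p) * μ (ball x (dist x y))) ∂μ ∂μ

/-- A metric density: a nonincreasing function `ρ : [0,∞) → (0,∞]` that is finite on `(0,∞)`. -/
structure MetricDensity where
  toFun : ℝ≥0 → ℝ≥0∞
  antitone : Antitone toFun
  pos : ∀ t, 0 < toFun t
  lt_top : ∀ t, 0 < t → toFun t < ⊤

instance : CoeFun MetricDensity (fun _ => ℝ≥0 → ℝ≥0∞) := ⟨MetricDensity.toFun⟩

section Deformation

variable {Z : Type*} [MetricSpace Z]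

/-- The cost `∑ⱼ (ρ(|xⱼ|) + ρ(|xⱼ₋₁|)) d(xⱼ, xⱼ₋₁)` of the chain `x₀ = c 0, …, xₙ = c n`,
where `|x| = d(x, b)`. -/
noncomputable def chainCost (ρ : MetricDensity) (b : Z) (n : ℕ) (c : ℕ → Z) : ℝ≥0∞ :=
  ∑ j ∈ Finset.range n,
    (ρ (nndist (c (j + 1)) b) + ρ (nndist (c j) b)) * edist (c (j + 1)) (c j)

/-- The sum-chain distance: the infimum of the costs of all finite chains in `Z` from `x` to `y`. -/
noncomputable def chainDist (ρ : MetricDensity) (b x y : Z) : ℝ≥0∞ :=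
  ⨅ (n : ℕ) (c : ℕ → Z) (_ : c 0 = x) (_ : c n = y), chainCost ρ b n c

/-- The set underlying the deformed space: `Z` if `ρ(0) < ∞`, and `Z \ {b}` if `ρ(0) = ∞`.
It is a type of its own, since it carries the metric `d̂` and not the restriction of `d`. -/
structure Deformed (ρ : MetricDensity) (b : Z) where
  val : Z
  property : ρ 0 < ⊤ ∨ val ≠ b

theorem Deformed.density_lt_top {ρ : MetricDensity} {b : Z} (x : Deformed ρ b) :
    ρ (nndist x.val b) < ⊤ := by
  by_cases h : x.val = b
  · rcases x.property with h0 | h0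
    · simpa [h] using h0
    · exact absurd h h0
  · exact ρ.lt_top _ (by simpa [pos_iff_ne_zero] using h)

theorem chainDist_le_cost (ρ : MetricDensity) (b : Z) (n : ℕ) (c : ℕ → Z) :
    chainDist ρ b (c 0) (c n) ≤ chainCost ρ b n c :=
  iInf_le_of_le n <| iInf_le_of_le c <| iInf_le_of_le rfl <| iInf_le_of_le rfl le_rfl

theorem le_chainDist {ρ : MetricDensity} {b x y : Z} {a : ℝ≥0∞}
    (h : ∀ (n : ℕ) (c : ℕ → Z), c 0 = x → c n = y → a ≤ chainCost ρ b n c) :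
    a ≤ chainDist ρ b x y :=
  le_iInf fun n => le_iInf fun c => le_iInf fun h0 => le_iInf fun h1 => h n c h0 h1

theorem chainDist_self (ρ : MetricDensity) (b x : Z) : chainDist ρ b x x = 0 := by
  have := chainDist_le_cost ρ b 0 (fun _ => x)
  simpa [chainCost] using this

theorem chainDist_le (ρ : MetricDensity) (b x y : Z) :
    chainDist ρ b x y ≤ (ρ (nndist x b) + ρ (nndist y b)) * edist x y := by
  have := chainDist_le_cost ρ b 1 (fun j => if j = 0 then x else y)
  simpa [chainCost, add_comm, edist_comm] using this

theorem chainDist_comm_le (ρ : MetricDensity) (b x y : Z) :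
    chainDist ρ b x y ≤ chainDist ρ b y x := by
  refine le_chainDist fun n c h0 hn => ?_
  have h := chainDist_le_cost ρ b n (fun j => c (n - j))
  simp only [Nat.sub_zero, Nat.sub_self, h0, hn] at h
  refine h.trans (le_of_eq ?_)
  unfold chainCost
  rw [← Finset.sum_range_reflect]
  refine Finset.sum_congr rfl fun j hj => ?_
  have hj' : j < n := Finset.mem_range.1 hj
  have e1 : n - (n - 1 - j + 1) = j := by omega
  have e2 : n - (n - 1 - j) = j + 1 := by omega
  simp only [e1, e2]
  rw [add_comm, edist_comm]

theorem chainDist_triangle (ρ : MetricDensity) (b x y z : Z) :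
    chainDist ρ b x z ≤ chainDist ρ b x y + chainDist ρ b y z := by
  have key : ∀ (n : ℕ) (c : ℕ → Z), c 0 = x → c n = y → ∀ (m : ℕ) (e : ℕ → Z),
      e 0 = y → e m = z → chainDist ρ b x z ≤ chainCost ρ b n c + chainCost ρ b m e := by
    intro n c c0 cn m e e0 em
    have h := chainDist_le_cost ρ b (n + m) (fun j => if j ≤ n then c j else e (j - n))
    have h1 : (if n + m ≤ n then c (n + m) else e (n + m - n)) = z := by
      by_cases hm : m = 0
      · subst hm; simp [cn, ← e0, em]
      · rw [if_neg (by omega)]; simp [em]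
    simp only [Nat.zero_le, if_true, c0, h1] at h
    refine h.trans (le_of_eq ?_)
    unfold chainCost
    rw [Finset.sum_range_add]
    congr 1
    · refine Finset.sum_congr rfl fun j hj => ?_
      have hj' : j < n := Finset.mem_range.1 hj
      have e1 : j ≤ n := by omega
      have e2 : j + 1 ≤ n := by omega
      simp only [e1, e2, if_true]
    · refine Finset.sum_congr rfl fun j _ => ?_
      have e1 : (if n + j ≤ n then c (n + j) else e (n + j - n)) = e j := by
        by_cases hj : j = 0
        · subst hj; simp [cn, e0]
        · rw [if_neg (by omega)]; simp
      have e2 : (if n + j + 1 ≤ n then c (n + j + 1) else e (n + j + 1 - n)) = e (j + 1) := by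
        rw [if_neg (by omega)]; congr 1; omega
      simp only [e1, e2]
  have : ∀ (n : ℕ) (c : ℕ → Z), c 0 = x → c n = y →
      chainDist ρ b x z ≤ chainCost ρ b n c + chainDist ρ b y z := by
    intro n c c0 cn
    rw [← tsub_le_iff_left]
    exact le_chainDist fun m e e0 em => tsub_le_iff_left.2 (key n c c0 cn m e e0 em)
  rw [← tsub_le_iff_right]
  exact le_chainDist fun n c c0 cn => tsub_le_iff_right.2 (this n c c0 cn)

/-- Lower bound for the chain distance, which shows that it separates points. -/
theorem le_chainDist_of_dist (ρ : MetricDensity) (b x y : Z) :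
    ρ (nndist x b + nndist x y) * edist x y ≤ chainDist ρ b x y := by
  refine le_chainDist fun n c h0 hn => ?_
  classical
  have hex : ∃ j, nndist x y ≤ nndist x (c j) := ⟨n, by rw [hn]⟩
  set k := Nat.find hex with hk
  have hkn : k ≤ n := Nat.find_min' hex (by rw [hn])
  have hkk : nndist x y ≤ nndist x (c k) := Nat.find_spec hex
  have hlt : ∀ j < k, nndist x (c j) < nndist x y := fun j hj => not_le.1 (Nat.find_min hex hj)
  calc ρ (nndist x b + nndist x y) * edist x y
      ≤ ρ (nndist x b + nndist x y) * edist (c 0) (c k) := by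
        rw [h0, edist_nndist, edist_nndist]
        gcongr
    _ ≤ ρ (nndist x b + nndist x y) * ∑ j ∈ Finset.range k, edist (c j) (c (j + 1)) := by
        gcongr
        exact edist_le_range_sum_edist c k
    _ = ∑ j ∈ Finset.range k, ρ (nndist x b + nndist x y) * edist (c j) (c (j + 1)) := by
        rw [Finset.mul_sum]
    _ ≤ ∑ j ∈ Finset.range k,
          (ρ (nndist (c (j + 1)) b) + ρ (nndist (c j) b)) * edist (c (j + 1)) (c j) := by
        refine Finset.sum_le_sum fun j hj => ?_
        rw [edist_comm (c j)]
        gcongr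
        refine le_add_left (ρ.antitone ?_)
        calc nndist (c j) b ≤ nndist (c j) x + nndist x b := nndist_triangle _ _ _
          _ ≤ nndist x b + nndist x y := by
            rw [add_comm, nndist_comm (c j)]
            gcongr
            exact (hlt j (Finset.mem_range.1 hj)).le
    _ ≤ chainCost ρ b n c := by
        unfold chainCost
        exact Finset.sum_le_sum_of_subset (Finset.range_mono hkn)

/-- `d̂` is a metric on the deformed space; it takes values in `[0,∞)`. -/
noncomputable instance (ρ : MetricDensity) (b : Z) : EMetricSpace (Deformed ρ b) where
  edist x y := chainDist ρ b x.val y.val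
  edist_self x := chainDist_self ρ b x.val
  edist_comm x y := le_antisymm (chainDist_comm_le ρ b _ _) (chainDist_comm_le ρ b _ _)
  edist_triangle x y z := chainDist_triangle ρ b _ _ _
  eq_of_edist_eq_zero {x y} h := by
    have h1 := le_chainDist_of_dist ρ b x.val y.val
    have h2 : chainDist ρ b x.val y.val = 0 := h
    rw [h2, nonpos_iff_eq_zero, mul_eq_zero] at h1
    have h3 : x.val = y.val := by
      rcases h1 with h1 | h1
      · exact absurd h1 (ρ.pos _).ne'
      · exact edist_eq_zero.1 h1
    cases x; cases y; cases h3; rfl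

noncomputable instance (ρ : MetricDensity) (b : Z) : MetricSpace (Deformed ρ b) :=
  EMetricSpace.toMetricSpace fun x y =>
    ((chainDist_le ρ b x.val y.val).trans_lt (ENNReal.mul_lt_top
      (ENNReal.add_lt_top.2 ⟨x.density_lt_top, y.density_lt_top⟩) (edist_lt_top _ _))).ne

/-- The metric completion of the deformed space. -/
abbrev DeformedCompletion (ρ : MetricDensity) (b : Z) : Type _ :=
  UniformSpace.Completion (Deformed ρ b)

noncomputable instance (ρ : MetricDensity) (b : Z) : MeasurableSpace (Deformed ρ b) := borel _

instance (ρ : MetricDensity) (b : Z) : BorelSpace (Deformed ρ b) := ⟨rfl⟩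

noncomputable instance (ρ : MetricDensity) (b : Z) : MeasurableSpace (DeformedCompletion ρ b) := borel _

instance (ρ : MetricDensity) (b : Z) : BorelSpace (DeformedCompletion ρ b) := ⟨rfl⟩

variable [MeasurableSpace Z]

/-- The measure `dν̂ = ρ^σ dν` on the deformed space. -/
noncomputable def deformedMeasure (ν : Measure Z) (ρ : MetricDensity) (b : Z) (σ : ℝ) :
    Measure (Deformed ρ b) :=
  (ν.comap Deformed.val).withDensity fun x => ρ (nndist x.val b) ^ σ

/-- The measure `ν̂` on the completion: points added by the completion have measure zero. -/
noncomputable def deformedMeasureCompletion (ν : Measure Z) (ρ : MetricDensity) (b : Z) (σ : ℝ) :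
    Measure (DeformedCompletion ρ b) :=
  (deformedMeasure ν ρ b σ).map fun x : Deformed ρ b => (x : DeformedCompletion ρ b)

/-- The density `ρ(t) = 1 / ((t + m₀) ν(B(b, t + m₀))^{1/σ})`; in particular `ρ(0) = ∞` if `m₀ = 0`.
The case `m₀ = 0` is flattening (or inversion), the case `m₀ = 1` sphericalization. -/
noncomputable def specialDensity {ν : Measure Z} {C : ℝ≥0} (hν : IsDoublingWith ν C) (b : Z)
    (m₀ : ℝ≥0) {σ : ℝ} (hσ : 0 < σ) : MetricDensity where
  toFun t := 1 / (((t + m₀ : ℝ≥0) : ℝ≥0∞) * ν (ball b (t + m₀)) ^ (1 / σ))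
  antitone s t hst := by
    have : 0 ≤ 1 / σ := by positivity
    dsimp only
    gcongr
  pos t := by
    have hf : ν (ball b (t + m₀)) < ⊤ :=
      (measure_mono (ball_subset_ball (by linarith))).trans_lt (hν.finite b (t + m₀ + 1) (by positivity))
    have : 0 ≤ 1 / σ := by positivity
    rw [one_div, ENNReal.inv_pos]
    exact ENNReal.mul_ne_top ENNReal.coe_ne_top (ENNReal.rpow_ne_top_of_nonneg this hf.ne)
  lt_top t ht := by
    have hp : (0 : ℝ) < t + m₀ := by positivity
    have hb : 0 < ν (ball b (t + m₀)) := by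
      have := hν.pos b ((t + m₀) / 2) (by positivity)
      rwa [mul_div_cancel₀ _ two_ne_zero] at this
    rw [one_div, ENNReal.inv_lt_top]
    refine ENNReal.mul_pos ?_ (ENNReal.rpow_pos_of_nonneg hb (by positivity)).ne'
    have : 0 < t + m₀ := by positivity
    exact_mod_cast this.ne'

end Deformation

/-! Write τ(x) = |x| + m₀, γ(t) = ν(B(b,t))^{-1/σ} and ω(t) = γ(t)/t, so that ρ(x) = ω(τ(x)). Two
facts drive the proof. The density is normalized so that ω(t)^σ ν(B(b,t)) = t^{-σ}
(`volumeWeight_rpow`). Uniform perfectness at b gives reverse doubling for balls about b, so γ drops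
by any prescribed factor once τ grows by a suitable factor (`exists_gaugeDecay`).

Metric: at distances from x small compared with τ(x) the weight is nearly constant, and d̂ is
comparable to ρ(x) d. For points farther apart, with τ(x) ≤ τ(y), d̂ is comparable to γ(τ(x)):
leaving the neighbourhood of x costs that much (`Deformed.le_dist`), and an outward chain costs no
more because its steps form a geometric series (`Deformed.dist_le_gauge`).

Measure: summing dyadic shells, {τ ≥ T} has ν̂-mass at most a constant times T^{-σ}
(`deformedVolume_tail_le`). A small d̂-ball is essentially a d-ball with constant density, so it
inherits doubling from ν. A large one lies in some {τ ≥ T} and has mass comparable to T^{-σ}, with T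
nearly the least τ on the ball.

Energy: since θp = σ and dν̂ = ρ^σ dν, it suffices that d̂^σ ν̂(B̂(x,d̂)) and (ρ(x)ρ(y)d)^σ
ν(B(x,d)) are comparable pointwise (`kernel_comparable`). For near points this is the local picture;
for far points both are comparable to ω(τ(x))^σ. -/

/-! ### Growth of balls under a doubling measure. -/

section DoublingMeasure

variable {X : Type*} [PseudoMetricSpace X] [MeasurableSpace X] {μ : Measure X} {C : ℝ≥0}

theorem IsDoublingWith.measure_ball_pos (hμ : IsDoublingWith μ C) (x : X) {r : ℝ} (hr : 0 < r) :
    0 < μ (ball x r) := by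
  have := hμ.pos x (r / 2) (by positivity)
  rwa [mul_div_cancel₀ _ two_ne_zero] at this

theorem IsDoublingWith.measure_ball_lt_top (hμ : IsDoublingWith μ C) (x : X) (r : ℝ) :
    μ (ball x r) < ⊤ := by
  rcases lt_or_ge 0 r with hr | hr
  · exact hμ.finite x r hr
  · simp [ball_eq_empty.2 hr]

theorem IsDoublingWith.real_ball_pos (hμ : IsDoublingWith μ C) (x : X) {r : ℝ} (hr : 0 < r) :
    0 < μ.real (ball x r) :=
  ENNReal.toReal_pos (hμ.measure_ball_pos x hr).ne' (hμ.measure_ball_lt_top x r).ne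

theorem IsDoublingWith.real_ball_mono (hμ : IsDoublingWith μ C) {x y : X} {r s : ℝ}
    (h : ball x r ⊆ ball y s) : μ.real (ball x r) ≤ μ.real (ball y s) :=
  measureReal_mono h (hμ.measure_ball_lt_top y s).ne

theorem IsDoublingWith.real_ball_two_mul (hμ : IsDoublingWith μ C) (x : X) {r : ℝ} (hr : 0 < r) :
    μ.real (ball x (2 * r)) ≤ C * μ.real (ball x r) := by
  have h := ENNReal.toReal_mono
    (ENNReal.mul_lt_top ENNReal.coe_lt_top (hμ.measure_ball_lt_top x r)).ne (hμ.doubling x r hr)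
  simpa [Measure.real] using h

theorem IsDoublingWith.real_ball_two_pow_mul (hμ : IsDoublingWith μ C) (x : X) {r : ℝ}
    (hr : 0 < r) (n : ℕ) : μ.real (ball x (2 ^ n * r)) ≤ (C : ℝ) ^ n * μ.real (ball x r) := by
  induction n with
  | zero => simp
  | succ n ih =>
    calc μ.real (ball x (2 ^ (n + 1) * r)) = μ.real (ball x (2 * (2 ^ n * r))) := by
          congr 2; ring
      _ ≤ C * μ.real (ball x (2 ^ n * r)) := hμ.real_ball_two_mul x (by positivity)
      _ ≤ C * ((C : ℝ) ^ n * μ.real (ball x r)) := by gcongr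
      _ = (C : ℝ) ^ (n + 1) * μ.real (ball x r) := by ring

/-- The factor by which the measure of a ball grows when its radius is multiplied by `Λ`. -/
noncomputable def growthFactor (C : ℝ≥0) (Λ : ℝ) : ℝ := (C : ℝ) ^ ⌈Λ⌉₊

theorem IsDoublingWith.growthFactor_pos (hμ : IsDoublingWith μ C) (Λ : ℝ) :
    0 < growthFactor C Λ := by
  have h : 0 < C := lt_trans zero_lt_one hμ.one_lt
  unfold growthFactor
  positivity

theorem IsDoublingWith.real_ball_le (hμ : IsDoublingWith μ C) {x y : X} {r s : ℝ} {Λ : ℝ}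
    (hs : 0 < s) (h : ball x r ⊆ ball y (Λ * s)) :
    μ.real (ball x r) ≤ growthFactor C Λ * μ.real (ball y s) := by
  refine le_trans (hμ.real_ball_mono (h.trans (ball_subset_ball ?_)))
    (hμ.real_ball_two_pow_mul y hs ⌈Λ⌉₊)
  -- The exponent ⌈Λ⌉ is wasteful compared with log₂ Λ, but Λ ≤ 2^⌈Λ⌉ needs no logarithm.
  have h1 : Λ ≤ (2 : ℝ) ^ ⌈Λ⌉₊ := (Nat.le_ceil Λ).trans (by exact_mod_cast Nat.lt_two_pow_self.le)
  gcongr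

theorem IsDoublingWith.real_ball_le_of_le (hμ : IsDoublingWith μ C) (x : X) {r s : ℝ} {Λ : ℝ}
    (hs : 0 < s) (h : r ≤ Λ * s) :
    μ.real (ball x r) ≤ growthFactor C Λ * μ.real (ball x s) :=
  hμ.real_ball_le hs (ball_subset_ball h)

end DoublingMeasure

/-! ### Shifted radius and volume gauge. -/

section Radius

variable {Z : Type*} [MetricSpace Z]

/-- The shifted distance `|x| + m₀` to the base point. -/
noncomputable def shiftedRadius (b : Z) (m₀ : ℝ≥0) (x : Z) : ℝ := dist x b + m₀

theorem le_shiftedRadius (b : Z) (m₀ : ℝ≥0) (x : Z) : m₀ ≤ shiftedRadius b m₀ x := by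
  simp [shiftedRadius]

theorem dist_le_shiftedRadius (b : Z) (m₀ : ℝ≥0) (x : Z) : dist x b ≤ shiftedRadius b m₀ x := by
  simp [shiftedRadius]

theorem UniformlyPerfectAt.exists_mem {b : Z} {m₀ : ℝ≥0} {κ : ℝ}
    (hb : UniformlyPerfectAt b m₀ κ) {r : ℝ} (hr : 0 < r)
    (hm : m₀ ≤ r) {x : Z} (hx : r ≤ dist x b) : ∃ z, r ≤ dist z b ∧ dist z b < κ * r := by
  obtain ⟨z, hz1, hz2⟩ := hb.nonempty r hr.ne' hm fun h => by
    have : x ∈ ball b r := h ▸ Set.mem_univ x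
    exact absurd (mem_ball.1 this) (not_lt.2 hx)
  exact ⟨z, by simpa using hz2, by simpa using hz1⟩

variable [MeasurableSpace Z]

/-- The function `t ↦ ν(B(b,t))^{-1/σ}`. -/
noncomputable def volumeGauge (ν : Measure Z) (b : Z) (σ t : ℝ) : ℝ := (ν.real (ball b t)) ^ (-(1 / σ))

end Radius

/-! ### The radial weight and its doubling behaviour. -/

section Weight

variable {Z : Type*} [MetricSpace Z] [MeasurableSpace Z]

/-- The weight `t ↦ t⁻¹ ν(B(b,t))^{-1/σ}`. -/
noncomputable def volumeWeight (ν : Measure Z) (b : Z) (σ t : ℝ) : ℝ := volumeGauge ν b σ t / t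

variable {ν : Measure Z} {C : ℝ≥0} {σ : ℝ}

theorem volumeGauge_pos (hν : IsDoublingWith ν C) (b : Z) {t : ℝ} (ht : 0 < t) :
    0 < volumeGauge ν b σ t :=
  Real.rpow_pos_of_pos (hν.real_ball_pos b ht) _

theorem volumeWeight_pos (hν : IsDoublingWith ν C) (b : Z) {t : ℝ} (ht : 0 < t) :
    0 < volumeWeight ν b σ t :=
  div_pos (volumeGauge_pos hν b ht) ht

theorem volumeWeight_mul_self (ν : Measure Z) (b : Z) (σ : ℝ) {t : ℝ} (ht : 0 < t) :
    volumeWeight ν b σ t * t = volumeGauge ν b σ t :=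
  div_mul_cancel₀ _ ht.ne'

theorem volumeGauge_anti (hν : IsDoublingWith ν C) (hσ : 0 < σ) (b : Z) {s t : ℝ} (hs : 0 < s)
    (hst : s ≤ t) : volumeGauge ν b σ t ≤ volumeGauge ν b σ s :=
  Real.rpow_le_rpow_of_nonpos (hν.real_ball_pos b hs)
    (hν.real_ball_mono (ball_subset_ball hst)) (by have := one_div_pos.2 hσ; linarith)

theorem volumeWeight_anti (hν : IsDoublingWith ν C) (hσ : 0 < σ) (b : Z) {s t : ℝ} (hs : 0 < s)
    (hst : s ≤ t) : volumeWeight ν b σ t ≤ volumeWeight ν b σ s := by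
  have h1 := volumeGauge_anti hν hσ b hs hst
  have h2 := (volumeGauge_pos (σ := σ) hν b hs).le
  unfold volumeWeight
  gcongr

/-- The comparison constant for the weight on points whose shifted radii differ by a factor
of at most two. -/
noncomputable def weightRatio (C : ℝ≥0) (σ : ℝ) : ℝ := 2 * (C : ℝ) ^ (1 / σ)

theorem two_le_weightRatio (hν : IsDoublingWith ν C) (hσ : 0 < σ) : 2 ≤ weightRatio C σ := by
  have h : (1 : ℝ) ≤ C := by exact_mod_cast hν.one_lt.le
  have := Real.one_le_rpow h (one_div_pos.2 hσ).le
  unfold weightRatio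
  linarith

theorem volumeGauge_le (hν : IsDoublingWith ν C) (hσ : 0 < σ) (b : Z) {s t : ℝ} (hs : 0 < s)
    (ht : 0 < t) (hst : t ≤ 2 * s) :
    volumeGauge ν b σ s ≤ weightRatio C σ / 2 * volumeGauge ν b σ t := by
  have hC : (0 : ℝ) < C := by exact_mod_cast lt_trans zero_lt_one hν.one_lt
  have hfs := hν.real_ball_pos b hs
  have hft := hν.real_ball_pos b ht
  have h1 : ν.real (ball b t) ≤ C * ν.real (ball b s) :=
    (hν.real_ball_mono (ball_subset_ball hst)).trans (hν.real_ball_two_mul b hs)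
  have h2 := Real.rpow_le_rpow hft.le h1 (one_div_pos.2 hσ).le
  rw [Real.mul_rpow hC.le hfs.le] at h2
  unfold volumeGauge weightRatio
  rw [Real.rpow_neg hfs.le, Real.rpow_neg hft.le, mul_div_cancel_left₀ _ two_ne_zero,
    ← div_eq_mul_inv, inv_eq_one_div, div_le_div_iff₀ (by positivity) (by positivity), one_mul]
  exact h2

theorem volumeWeight_le (hν : IsDoublingWith ν C) (hσ : 0 < σ) (b : Z) {s t : ℝ} (hs : 0 < s)
    (ht : 0 < t) (hst : t ≤ 2 * s) :
    volumeWeight ν b σ s ≤ weightRatio C σ * volumeWeight ν b σ t := by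
  have h1 := volumeGauge_le hν hσ b hs ht hst
  have h2 := (volumeGauge_pos (σ := σ) hν b ht).le
  have h3 := two_le_weightRatio hν hσ
  unfold volumeWeight
  calc volumeGauge ν b σ s / s ≤ (weightRatio C σ / 2 * volumeGauge ν b σ t) / (t / 2) := by
        gcongr
        linarith
    _ = weightRatio C σ * (volumeGauge ν b σ t / t) := by field_simp

/-- The density is chosen for this cancellation: the ball at scale t, weighted by its boundary
density, has mass t^{-σ} whatever ν is. -/
theorem volumeWeight_rpow (hν : IsDoublingWith ν C) (hσ : 0 < σ) (b : Z) {t : ℝ} (ht : 0 < t) :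
    volumeWeight ν b σ t ^ σ * ν.real (ball b t) = t ^ (-σ) := by
  have hf := hν.real_ball_pos b ht
  unfold volumeWeight volumeGauge
  rw [Real.div_rpow (by positivity) ht.le, ← Real.rpow_mul hf.le, Real.rpow_neg ht.le]
  have : -(1 / σ) * σ = -1 := by field_simp
  rw [this, Real.rpow_neg_one]
  field_simp

theorem specialDensity_eq (hν : IsDoublingWith ν C) (hσ : 0 < σ) (b : Z) (m₀ t : ℝ≥0)
    (ht : (0 : ℝ) < t + m₀) :
    specialDensity hν b m₀ hσ t = ENNReal.ofReal (volumeWeight ν b σ (t + m₀)) := by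
  have hf := hν.real_ball_pos b ht
  have hlt := hν.measure_ball_lt_top b ((t : ℝ) + m₀)
  change 1 / (((t + m₀ : ℝ≥0) : ℝ≥0∞) * ν (ball b (t + m₀)) ^ (1 / σ)) = _
  have h1 : (((t + m₀ : ℝ≥0) : ℝ≥0∞)) = ENNReal.ofReal (t + m₀) := by
    rw [ENNReal.ofReal_add (by positivity) (by positivity)]; simp
  have h2 : ν (ball b (t + m₀)) = ENNReal.ofReal (ν.real (ball b (t + m₀))) :=
    (ENNReal.ofReal_toReal hlt.ne).symm
  rw [h1, h2, ENNReal.ofReal_rpow_of_pos hf, ← ENNReal.ofReal_mul ht.le, one_div,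
    ← ENNReal.ofReal_inv_of_pos (by positivity)]
  congr 1
  unfold volumeWeight volumeGauge
  rw [Real.rpow_neg hf.le]
  field_simp

theorem specialDensity_nndist (hν : IsDoublingWith ν C) (hσ : 0 < σ) (b : Z) (m₀ : ℝ≥0) (x : Z)
    (hx : 0 < shiftedRadius b m₀ x) :
    specialDensity hν b m₀ hσ (nndist x b) =
      ENNReal.ofReal (volumeWeight ν b σ (shiftedRadius b m₀ x)) := by
  rw [specialDensity_eq hν hσ b m₀ _ (by simpa [shiftedRadius] using hx)]
  simp [shiftedRadius]

end Weight

/-! ### Reverse doubling at the base point and decay of the gauge. -/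

section ReverseDoubling

variable {Z : Type*} [MetricSpace Z] [MeasurableSpace Z] [BorelSpace Z]
  {ν : Measure Z} {C : ℝ≥0} {b : Z} {m₀ : ℝ≥0} {κ σ : ℝ}

/-- Uniform perfectness places z with 2t ≤ |z| < 2κt. The balls of radius t about b and z are
disjoint, both lie in the large ball, and doubling bounds the mass of the second below by a fixed
fraction of the first. The point x certifies that B(b,2t) is not the whole space. -/
theorem real_ball_reverse_doubling (hν : IsDoublingWith ν C) (hb : UniformlyPerfectAt b m₀ κ)
    {t : ℝ} (ht : 0 < t) (hm : m₀ ≤ t) {x : Z} (hx : 2 * t ≤ dist x b) :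
    (1 + (growthFactor C (2 * κ + 1))⁻¹) * ν.real (ball b t) ≤
      ν.real (ball b ((2 * κ + 1) * t)) := by
  obtain ⟨z, hz1, hz2⟩ := hb.exists_mem (r := 2 * t) (by positivity) (by linarith) hx
  have hκ := hb.one_lt
  have hD := hν.growthFactor_pos (2 * κ + 1)
  have h1 : ν.real (ball b t) ≤ growthFactor C (2 * κ + 1) * ν.real (ball z t) :=
    hν.real_ball_le ht (ball_subset_ball' (by rw [dist_comm]; nlinarith))
  have hdisj : Disjoint (ball b t) (ball z t) :=
    ball_disjoint_ball (by rw [dist_comm]; linarith)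
  have h2 : ν.real (ball b t) + ν.real (ball z t) ≤ ν.real (ball b ((2 * κ + 1) * t)) := by
    rw [← measureReal_union hdisj measurableSet_ball (hν.measure_ball_lt_top _ _).ne
      (hν.measure_ball_lt_top _ _).ne]
    refine measureReal_mono (Set.union_subset (ball_subset_ball (by nlinarith))
      (ball_subset_ball' (by nlinarith))) (hν.measure_ball_lt_top _ _).ne
  have h3 : (growthFactor C (2 * κ + 1))⁻¹ * ν.real (ball b t) ≤ ν.real (ball z t) := by
    rwa [inv_mul_le_iff₀ hD]
  linarith

theorem real_ball_reverse_doubling_pow (hν : IsDoublingWith ν C) (hb : UniformlyPerfectAt b m₀ κ)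
    {t : ℝ} (ht : 0 < t) (hm : m₀ ≤ t) (n : ℕ) {x : Z} (hx : 2 * ((2 * κ + 1) ^ n * t) ≤ dist x b) :
    (1 + (growthFactor C (2 * κ + 1))⁻¹) ^ n * ν.real (ball b t) ≤
      ν.real (ball b ((2 * κ + 1) ^ n * t)) := by
  have hκ := hb.one_lt
  have hD := hν.growthFactor_pos (2 * κ + 1)
  induction n with
  | zero => simp
  | succ n ih =>
    have hn : 1 ≤ (2 * κ + 1) ^ n := one_le_pow₀ (by linarith)
    have hx' : 2 * ((2 * κ + 1) ^ n * t) ≤ dist x b := by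
      refine le_trans ?_ hx
      rw [pow_succ]
      have : 0 < (2 * κ + 1) ^ n * t := by positivity
      nlinarith
    calc (1 + (growthFactor C (2 * κ + 1))⁻¹) ^ (n + 1) * ν.real (ball b t)
        = (1 + (growthFactor C (2 * κ + 1))⁻¹) *
          ((1 + (growthFactor C (2 * κ + 1))⁻¹) ^ n * ν.real (ball b t)) := by ring
      _ ≤ (1 + (growthFactor C (2 * κ + 1))⁻¹) * ν.real (ball b ((2 * κ + 1) ^ n * t)) := by
        gcongr
        exact ih hx'
      _ ≤ ν.real (ball b ((2 * κ + 1) * ((2 * κ + 1) ^ n * t))) :=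
        real_ball_reverse_doubling hν hb (by positivity) (by nlinarith) hx'
      _ = _ := by congr 2; ring

/-- Along the points of the space, the volume gauge decays by the factor `q` when the shifted
radius grows by the factor `K`. -/
def GaugeDecay (ν : Measure Z) (b : Z) (m₀ : ℝ≥0) (σ q K : ℝ) : Prop :=
  ∀ x y : Z, 0 < shiftedRadius b m₀ y → K * shiftedRadius b m₀ y ≤ shiftedRadius b m₀ x →
    q * volumeGauge ν b σ (shiftedRadius b m₀ x) ≤ volumeGauge ν b σ (shiftedRadius b m₀ y)

/-- Iterated reverse doubling, raised to the power -1/σ. The factor K is produced before the space,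
so it depends only on C, κ, σ and q. -/
theorem exists_gaugeDecay (C : ℝ≥0) (κ : ℝ) {σ : ℝ} (hσ : 0 < σ) (hκ : 1 < κ) (hC : 1 < C)
    {q : ℝ} (hq : 0 < q) :
    ∃ K : ℝ, 2 ≤ K ∧ ∀ (Z : Type*) [MetricSpace Z] [MeasurableSpace Z] [BorelSpace Z]
      (ν : Measure Z) (b : Z) (m₀ : ℝ≥0), IsDoublingWith ν C → UniformlyPerfectAt b m₀ κ →
      GaugeDecay ν b m₀ σ q K := by
  have hC0 : 0 < C := lt_trans zero_lt_one hC
  have hD : 0 < growthFactor C (2 * κ + 1) := by unfold growthFactor; positivity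
  obtain ⟨n, hn⟩ := pow_unbounded_of_one_lt (q ^ σ)
    (show 1 < 1 + (growthFactor C (2 * κ + 1))⁻¹ by simpa using hD)
  -- The summand 1 pays for the shift: since m₀ ≤ τ(y), the bound K τ(y) ≤ τ(x) leaves 2(2κ+1)^n
  -- τ(y) ≤ |x|.
  refine ⟨2 * (2 * κ + 1) ^ n + 1, by have : 1 ≤ (2 * κ + 1) ^ n := one_le_pow₀ (by linarith)
                                      linarith, ?_⟩
  intro Z _ _ _ ν b m₀ hν hb x y hy hxy
  have hpow : 1 ≤ (2 * κ + 1) ^ n := one_le_pow₀ (by linarith)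
  have hm := le_shiftedRadius b m₀ y
  have hx : 2 * ((2 * κ + 1) ^ n * shiftedRadius b m₀ y) ≤ dist x b := by
    have : shiftedRadius b m₀ x = dist x b + m₀ := rfl
    linarith
  have h1 := real_ball_reverse_doubling_pow hν hb hy hm n hx
  have hfy := hν.real_ball_pos b hy
  have h2 : q ^ σ * ν.real (ball b (shiftedRadius b m₀ y)) ≤
      ν.real (ball b (shiftedRadius b m₀ x)) := by
    refine le_trans (le_trans ?_ h1) (hν.real_ball_mono (ball_subset_ball ?_))
    · gcongr
    · nlinarith
  have h3 := Real.rpow_le_rpow_of_nonpos (by positivity) h2 (z := -(1 / σ))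
    (by have := one_div_pos.2 hσ; linarith)
  rw [Real.mul_rpow (by positivity) hfy.le, ← Real.rpow_mul hq.le] at h3
  have : σ * -(1 / σ) = -1 := by field_simp
  rw [this, Real.rpow_neg_one] at h3
  unfold volumeGauge
  rwa [le_inv_mul_iff₀ hq] at h3

end ReverseDoubling

/-! ### Lower bounds for chain distances. -/

section ChainDist

theorem Deformed.val_injective {Z : Type*} (ρ : MetricDensity) (b : Z) :
    Function.Injective (Deformed.val : Deformed ρ b → Z) := by
  rintro ⟨x, _⟩ ⟨y, _⟩ rfl
  rfl

variable {Z : Type*} [MetricSpace Z]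

/-- Cut a chain where it first reaches distance s from x. This piece has length at least s, and each
of its steps starts at distance less than s from x, where the density is at least ρ(|x| + s). -/
theorem le_chainDist_of_le_nndist (ρ : MetricDensity) (b : Z) {x y : Z} {s : ℝ≥0}
    (hs : s ≤ nndist x y) : ρ (nndist x b + s) * s ≤ chainDist ρ b x y := by
  refine le_chainDist fun n c h0 hn => ?_
  classical
  have hex : ∃ j, s ≤ nndist x (c j) := ⟨n, by rwa [hn]⟩
  set k := Nat.find hex with hk
  have hkn : k ≤ n := Nat.find_min' hex (by rwa [hn])
  have hkk : s ≤ nndist x (c k) := Nat.find_spec hex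
  have hlt : ∀ j < k, nndist x (c j) < s := fun j hj => not_le.1 (Nat.find_min hex hj)
  calc ρ (nndist x b + s) * s
      ≤ ρ (nndist x b + s) * edist (c 0) (c k) := by
        rw [h0, edist_nndist]
        gcongr
    _ ≤ ρ (nndist x b + s) * ∑ j ∈ Finset.range k, edist (c j) (c (j + 1)) := by
        gcongr
        exact edist_le_range_sum_edist c k
    _ = ∑ j ∈ Finset.range k, ρ (nndist x b + s) * edist (c j) (c (j + 1)) := by
        rw [Finset.mul_sum]
    _ ≤ ∑ j ∈ Finset.range k,
          (ρ (nndist (c (j + 1)) b) + ρ (nndist (c j) b)) * edist (c (j + 1)) (c j) := by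
        refine Finset.sum_le_sum fun j hj => ?_
        rw [edist_comm (c j)]
        gcongr
        refine le_add_left (ρ.antitone ?_)
        calc nndist (c j) b ≤ nndist (c j) x + nndist x b := nndist_triangle _ _ _
          _ ≤ nndist x b + s := by
            rw [add_comm, nndist_comm (c j)]
            gcongr
            exact (hlt j (Finset.mem_range.1 hj)).le
    _ ≤ chainCost ρ b n c := Finset.sum_le_sum_of_subset (Finset.range_mono hkn)

theorem Deformed.edist_eq {ρ : MetricDensity} {b : Z} (x y : Deformed ρ b) :
    edist x y = chainDist ρ b x.val y.val := rfl

theorem shiftedRadius_le_add (b : Z) (m₀ : ℝ≥0) (x y : Z) :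
    shiftedRadius b m₀ y ≤ shiftedRadius b m₀ x + dist x y := by
  have := dist_triangle y x b
  rw [dist_comm y x] at this
  unfold shiftedRadius
  linarith

theorem dist_le_shiftedRadius_add (b : Z) (m₀ : ℝ≥0) (x y : Z) :
    dist x y ≤ shiftedRadius b m₀ x + shiftedRadius b m₀ y :=
  (dist_triangle_right x y b).trans
    (add_le_add (dist_le_shiftedRadius _ _ _) (dist_le_shiftedRadius _ _ _))

end ChainDist

/-! ### Two-sided estimates of the deformed metric. -/

section SpecialDensity

variable {Z : Type*} [MetricSpace Z] [MeasurableSpace Z]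

/-- The deformation of `Z` by the special density. -/
abbrev DeformedSpace {ν : Measure Z} {C : ℝ≥0} (hν : IsDoublingWith ν C) (b : Z) (m₀ : ℝ≥0)
    {σ : ℝ} (hσ : 0 < σ) : Type _ :=
  Deformed (specialDensity hν b m₀ hσ) b

variable {ν : Measure Z} {C : ℝ≥0} {hν : IsDoublingWith ν C} {b : Z} {m₀ : ℝ≥0} {σ κ : ℝ}
  {hσ : 0 < σ}

local notation "τ" => shiftedRadius b m₀
local notation "γ" => volumeGauge ν b σ
local notation "ω" => volumeWeight ν b σ

theorem Deformed.shiftedRadius_pos (x : DeformedSpace hν b m₀ hσ) : 0 < τ x.val := by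
  have h0 : (0 : ℝ) ≤ m₀ := m₀.2
  rcases eq_or_ne m₀ 0 with rfl | hm
  · have hx : x.val ≠ b := by
      rcases x.property with h | h
      · refine absurd h (not_lt.2 (top_le_iff.2 ?_))
        change 1 / (((0 + 0 : ℝ≥0) : ℝ≥0∞) * _) = ⊤
        simp
      · exact h
    have := dist_pos.2 hx
    simpa [shiftedRadius] using hx
  · have : (0 : ℝ) < m₀ := by exact_mod_cast pos_iff_ne_zero.2 hm
    unfold shiftedRadius
    positivity

theorem Deformed.exists_val_eq {z : Z} (hz : 0 < τ z) :
    ∃ x : DeformedSpace hν b m₀ hσ, x.val = z := by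
  refine ⟨⟨z, ?_⟩, rfl⟩
  by_cases h : z = b
  · left
    have := specialDensity_nndist hν hσ b m₀ z hz
    rw [h, nndist_self] at this
    simp [this]
  · exact Or.inr h

theorem Deformed.dist_le (x y : DeformedSpace hν b m₀ hσ) :
    dist x y ≤ (ω (τ x.val) + ω (τ y.val)) * dist x.val y.val := by
  have h := chainDist_le (specialDensity hν b m₀ hσ) b x.val y.val
  have hx := (volumeWeight_pos (σ := σ) hν b x.shiftedRadius_pos).le
  have hy := (volumeWeight_pos (σ := σ) hν b y.shiftedRadius_pos).le
  rw [specialDensity_nndist _ _ _ _ _ x.shiftedRadius_pos,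
    specialDensity_nndist _ _ _ _ _ y.shiftedRadius_pos, ← Deformed.edist_eq, edist_dist,
    edist_dist, ← ENNReal.ofReal_add hx hy, ← ENNReal.ofReal_mul (by positivity)] at h
  exact (ENNReal.ofReal_le_ofReal_iff (by positivity)).1 h

theorem Deformed.dist_le_of_le (x y : DeformedSpace hν b m₀ hσ) (h : τ x.val ≤ τ y.val) :
    dist x y ≤ 2 * ω (τ x.val) * dist x.val y.val := by
  refine (x.dist_le y).trans ?_
  have := volumeWeight_anti hν hσ b x.shiftedRadius_pos h
  gcongr
  linarith

/-- Truncating at s ≤ τ(x) keeps the radius τ(x) + s within a factor two of τ(x), where the weight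
has changed only by a bounded factor. -/
theorem Deformed.le_dist (x y : DeformedSpace hν b m₀ hσ) :
    ω (τ x.val) * min (dist x.val y.val) (τ x.val) ≤ weightRatio C σ * dist x y := by
  have hx := x.shiftedRadius_pos
  set s := min (dist x.val y.val) (τ x.val) with hs
  have hs0 : 0 ≤ s := le_min dist_nonneg hx.le
  have hst : s ≤ τ x.val := min_le_right _ _
  have h := le_chainDist_of_le_nndist (specialDensity hν b m₀ hσ) b (x := x.val) (y := y.val)
    (s := s.toNNReal) (by
      rw [← NNReal.coe_le_coe, Real.coe_toNNReal s hs0]; exact min_le_left _ _)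
  have e : ((nndist x.val b + s.toNNReal : ℝ≥0) : ℝ) + m₀ = τ x.val + s := by
    simp [shiftedRadius, hs0]; ring
  have hpos : 0 < τ x.val + s := by positivity
  have hw := (volumeWeight_pos (σ := σ) hν b hpos).le
  have es : (s.toNNReal : ℝ≥0∞) = ENNReal.ofReal s := rfl
  rw [specialDensity_eq hν hσ b m₀ _ (by rwa [e]), e, es, ← ENNReal.ofReal_mul hw,
    ← Deformed.edist_eq, edist_dist, ENNReal.ofReal_le_ofReal_iff dist_nonneg] at h
  have h2 := volumeWeight_le hν hσ b hx hpos (by linarith)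
  have h3 := two_le_weightRatio hν hσ
  calc ω (τ x.val) * s ≤ weightRatio C σ * ω (τ x.val + s) * s := by gcongr
    _ = weightRatio C σ * (ω (τ x.val + s) * s) := by ring
    _ ≤ _ := by gcongr

/-- The space need not be connected, so the chain jumps outward through points supplied by uniform
perfectness. Each jump from x costs at most 2(2+κK)γ(τ(x)) and lands where γ has halved, so the
costs sum geometrically. -/
theorem Deformed.dist_le_gauge (hb : UniformlyPerfectAt b m₀ κ) {K : ℝ} (hK : 2 ≤ K)
    (hdecay : GaugeDecay ν b m₀ σ 2 K) (x y : DeformedSpace hν b m₀ hσ)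
    (h : τ x.val ≤ τ y.val) : dist x y ≤ 4 * (2 + κ * K) * γ (τ x.val) := by
  have hκ := hb.one_lt
  -- The exponent n only counts down: every jump at least doubles τ. It does not enter the bound.
  have key : ∀ n : ℕ, ∀ x y : DeformedSpace hν b m₀ hσ, τ x.val ≤ τ y.val →
      τ y.val ≤ 2 ^ n * τ x.val → dist x y ≤ 4 * (2 + κ * K) * γ (τ x.val) := by
    intro n
    induction n with
    | zero =>
      intro x y hxy hy
      refine (x.dist_le_of_le y hxy).trans ?_
      have hx := x.shiftedRadius_pos
      have hw := volumeWeight_pos (σ := σ) hν b hx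
      have := dist_le_shiftedRadius_add b m₀ x.val y.val
      rw [← volumeWeight_mul_self ν b σ hx]
      have h1 : dist x.val y.val ≤ 2 * τ x.val := by linarith
      have h2 : 0 ≤ κ * K := by positivity
      nlinarith [mul_pos hw hx, mul_nonneg h2 (mul_pos hw hx).le]
    | succ n ih =>
      intro x y hxy hy
      have hx := x.shiftedRadius_pos
      have hw := volumeWeight_pos (σ := σ) hν b hx
      have h2 : 0 ≤ κ * K := by positivity
      -- Beyond this threshold |y| ≥ κKτ(x), since m₀ ≤ τ(x). Hence an intermediate point z with
      -- Kτ(x) ≤ |z| < κKτ(x) exists and satisfies τ(z) ≤ τ(y).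
      rcases le_or_gt (τ y.val) ((1 + κ * K) * τ x.val) with hyx | hyx
      · refine (x.dist_le_of_le y hxy).trans ?_
        have := dist_le_shiftedRadius_add b m₀ x.val y.val
        rw [← volumeWeight_mul_self ν b σ hx]
        have h1 : dist x.val y.val ≤ (2 + κ * K) * τ x.val := by linarith
        calc 2 * ω (τ x.val) * dist x.val y.val
            ≤ 2 * ω (τ x.val) * ((2 + κ * K) * τ x.val) := by gcongr
          _ ≤ 4 * ω (τ x.val) * ((2 + κ * K) * τ x.val) := by gcongr; norm_num
          _ = _ := by ring
      · have hm := le_shiftedRadius b m₀ x.val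
        have hyb : κ * K * τ x.val ≤ dist y.val b := by
          have : τ y.val = dist y.val b + m₀ := rfl
          linarith
        have hr : 0 < K * τ x.val := by positivity
        have hr1 : K * τ x.val ≤ κ * (K * τ x.val) := by nlinarith
        obtain ⟨z₀, hz1, hz2⟩ := hb.exists_mem hr (by nlinarith) (x := y.val) (by linarith)
        have hm0 : (0 : ℝ) ≤ m₀ := m₀.2
        have hzτ : τ z₀ = dist z₀ b + m₀ := rfl
        have hyτ : τ y.val = dist y.val b + m₀ := rfl
        obtain ⟨z, rfl⟩ := Deformed.exists_val_eq (hν := hν) (hσ := hσ) (b := b) (m₀ := m₀)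
          (z := z₀) (by linarith)
        have hxz : τ x.val ≤ τ z.val := by nlinarith
        have hzy := ih z y (by linarith) (by
          have : 2 * τ x.val ≤ τ z.val := by nlinarith
          calc τ y.val ≤ 2 ^ n * (2 * τ x.val) := by rw [pow_succ] at hy; linarith
            _ ≤ 2 ^ n * τ z.val := by gcongr)
        have hg := hdecay z.val x.val hx (by linarith)
        have hdz : dist x.val z.val ≤ (2 + κ * K) * τ x.val := by
          have h3 := dist_triangle_right x.val z.val b
          have h4 := dist_le_shiftedRadius b m₀ x.val
          nlinarith
        have hxz' : dist x z ≤ 2 * (2 + κ * K) * γ (τ x.val) := by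
          refine (x.dist_le_of_le z hxz).trans ?_
          rw [← volumeWeight_mul_self ν b σ hx]
          calc 2 * ω (τ x.val) * dist x.val z.val
              ≤ 2 * ω (τ x.val) * ((2 + κ * K) * τ x.val) := by gcongr
            _ = _ := by ring
        have htri := dist_triangle x z y
        have : (2 + κ * K) * (2 * γ (τ z.val)) ≤ (2 + κ * K) * γ (τ x.val) := by gcongr
        linarith
  obtain ⟨n, hn⟩ := pow_unbounded_of_one_lt (τ y.val / τ x.val) (one_lt_two)
  exact key n x y h ((div_le_iff₀ x.shiftedRadius_pos).1 hn.le)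

/-- On points close to `x`, the weight is comparable to its value at `x`. -/
theorem volumeWeight_comparable (hν : IsDoublingWith ν C) (hσ : 0 < σ) {x y : Z} (hx : 0 < τ x)
    (h : dist x y ≤ τ x / 2) :
    0 < τ y ∧ ω (τ y) ≤ weightRatio C σ * ω (τ x) ∧ ω (τ x) ≤ weightRatio C σ * ω (τ y) := by
  have h1 := shiftedRadius_le_add b m₀ x y
  have h2 := shiftedRadius_le_add b m₀ y x
  rw [dist_comm] at h2
  have hy : 0 < τ y := by linarith
  exact ⟨hy, volumeWeight_le hν hσ b hy hx (by linarith),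
    volumeWeight_le hν hσ b hx hy (by linarith)⟩

/-- When r is small compared with the gauge, the minimum in `Deformed.le_dist` is below τ(x)/2,
hence is the distance itself. -/
theorem Deformed.dist_lt_of_dist_lt (x y : DeformedSpace hν b m₀ hσ) {r : ℝ}
    (hr : weightRatio C σ * r ≤ γ (τ x.val) / 2) (h : dist x y < r) :
    dist x.val y.val < weightRatio C σ * r / ω (τ x.val) ∧ dist x.val y.val < τ x.val / 2 := by
  have hx := x.shiftedRadius_pos
  have hw := volumeWeight_pos (σ := σ) hν b hx
  have ha := two_le_weightRatio hν hσ
  have h1 : ω (τ x.val) * min (dist x.val y.val) (τ x.val) < weightRatio C σ * r :=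
    (x.le_dist y).trans_lt (by gcongr)
  rw [← volumeWeight_mul_self ν b σ hx] at hr
  have h2 : min (dist x.val y.val) (τ x.val) < τ x.val / 2 := by
    by_contra hc
    nlinarith
  have h3 : min (dist x.val y.val) (τ x.val) = dist x.val y.val := by
    rcases min_choice (dist x.val y.val) (τ x.val) with h | h
    · exact h
    · rw [h] at h2; linarith
  rw [h3] at h1 h2
  exact ⟨by rwa [lt_div_iff₀ hw, mul_comm], h2⟩

theorem Deformed.dist_le_of_dist_le (x y : DeformedSpace hν b m₀ hσ)
    (h : dist x.val y.val ≤ τ x.val / 2) :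
    dist x y ≤ (1 + weightRatio C σ) * ω (τ x.val) * dist x.val y.val := by
  have := (volumeWeight_comparable hν hσ x.shiftedRadius_pos h).2.1
  refine (x.dist_le y).trans ?_
  gcongr
  linarith

end SpecialDensity

/-! ### Topology of the deformed space; mass of tails and small balls. -/

section Measure

variable {Z : Type*} [MetricSpace Z] [MeasurableSpace Z]
  {ν : Measure Z} {C : ℝ≥0} {hν : IsDoublingWith ν C} {b : Z} {m₀ : ℝ≥0} {σ κ : ℝ}
  {hσ : 0 < σ}

local notation "τ" => shiftedRadius b m₀
local notation "γ" => volumeGauge ν b σ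
local notation "ω" => volumeWeight ν b σ

/-- Near each x the two metrics agree up to factors comparable to ω(τ(x)), so they induce the same
topology; this is one direction. -/
theorem Deformed.continuous_val :
    Continuous (Deformed.val : DeformedSpace hν b m₀ hσ → Z) := by
  refine Metric.continuous_iff'.2 fun x ε hε => ?_
  have hx := x.shiftedRadius_pos
  have hw := volumeWeight_pos (σ := σ) hν b hx
  have hg := volumeGauge_pos (σ := σ) hν b hx
  have ha : 0 < weightRatio C σ := by linarith [two_le_weightRatio hν hσ]
  set r := min (γ (τ x.val) / 2 / weightRatio C σ) (ε * ω (τ x.val) / weightRatio C σ) with hr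
  have hr0 : 0 < r := lt_min (by positivity) (by positivity)
  filter_upwards [ball_mem_nhds x hr0] with y hy
  have h1 := (x.dist_lt_of_dist_lt y (r := r)
    (by rw [← le_div_iff₀' ha]; exact min_le_left _ _) (by rwa [dist_comm])).1
  rw [dist_comm]
  refine h1.trans_le ?_
  rw [div_le_iff₀ hw, ← le_div_iff₀' ha]
  exact min_le_right _ _

theorem Deformed.isOpenMap_val :
    IsOpenMap (Deformed.val : DeformedSpace hν b m₀ hσ → Z) := by
  refine IsOpenMap.of_nhds_le fun x U hU => ?_
  obtain ⟨ε, hε, hεU⟩ := Metric.mem_nhds_iff.1 (Filter.mem_map.1 hU)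
  have hx := x.shiftedRadius_pos
  have hw := volumeWeight_pos (σ := σ) hν b hx
  have ha : 0 < weightRatio C σ := by linarith [two_le_weightRatio hν hσ]
  have hq : 0 < (1 + weightRatio C σ) * ω (τ x.val) := by positivity
  refine Metric.mem_nhds_iff.2 ⟨min (τ x.val / 2) (ε / ((1 + weightRatio C σ) * ω (τ x.val))),
    lt_min (by positivity) (by positivity), fun z hz => ?_⟩
  rw [mem_ball, dist_comm] at hz
  have hz1 := hz.trans_le (min_le_left _ _)
  obtain ⟨y, rfl⟩ := Deformed.exists_val_eq (hν := hν) (hσ := hσ)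
    (volumeWeight_comparable hν hσ hx hz1.le).1
  refine hεU ?_
  rw [mem_ball, dist_comm]
  refine (x.dist_le_of_dist_le y hz1.le).trans_lt ?_
  have := hz.trans_le (min_le_right _ _)
  rwa [lt_div_iff₀ hq, mul_comm] at this

theorem Deformed.isOpenEmbedding_val :
    Topology.IsOpenEmbedding (Deformed.val : DeformedSpace hν b m₀ hσ → Z) :=
  .of_continuous_injective_isOpenMap Deformed.continuous_val (Deformed.val_injective _ _)
    Deformed.isOpenMap_val

variable [BorelSpace Z]

theorem Deformed.measurableEmbedding_val :
    MeasurableEmbedding (Deformed.val : DeformedSpace hν b m₀ hσ → Z) :=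
  Deformed.isOpenEmbedding_val.measurableEmbedding

/-- The measure `ρ^σ dν` on the deformation by the special density. -/
noncomputable abbrev deformedVolume {ν : Measure Z} {C : ℝ≥0} (hν : IsDoublingWith ν C) (b : Z)
    (m₀ : ℝ≥0) {σ : ℝ} (hσ : 0 < σ) : Measure (DeformedSpace hν b m₀ hσ) :=
  deformedMeasure ν (specialDensity hν b m₀ hσ) b σ

omit [BorelSpace Z] in
theorem specialDensity_rpow (x : DeformedSpace hν b m₀ hσ) :
    specialDensity hν b m₀ hσ (nndist x.val b) ^ σ = ENNReal.ofReal (ω (τ x.val) ^ σ) := by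
  rw [specialDensity_nndist hν hσ b m₀ _ x.shiftedRadius_pos,
    ENNReal.ofReal_rpow_of_pos (volumeWeight_pos hν b x.shiftedRadius_pos)]

theorem deformedVolume_le {S : Set (DeformedSpace hν b m₀ hσ)} {T : Set Z} {q : ℝ}
    (hT : MeasurableSet T) (hST : ∀ x ∈ S, x.val ∈ T)
    (hq : ∀ x : DeformedSpace hν b m₀ hσ, x.val ∈ T → ω (τ x.val) ≤ q) :
    deformedVolume hν b m₀ hσ S ≤ ENNReal.ofReal (q ^ σ) * ν T := by
  have hm : MeasurableSet (Deformed.val ⁻¹' T : Set (DeformedSpace hν b m₀ hσ)) :=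
    Deformed.measurableEmbedding_val.measurable hT
  calc deformedVolume hν b m₀ hσ S
      ≤ deformedVolume hν b m₀ hσ (Deformed.val ⁻¹' T) := measure_mono hST
    _ = ∫⁻ x in Deformed.val ⁻¹' T, specialDensity hν b m₀ hσ (nndist x.val b) ^ σ
          ∂(ν.comap Deformed.val) := withDensity_apply _ hm
    _ ≤ ∫⁻ _ in Deformed.val ⁻¹' T, ENNReal.ofReal (q ^ σ) ∂(ν.comap Deformed.val) := by
        refine setLIntegral_mono' hm fun x hx => ?_
        rw [specialDensity_rpow]
        have := (volumeWeight_pos (σ := σ) hν b x.shiftedRadius_pos).le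
        exact ENNReal.ofReal_le_ofReal (Real.rpow_le_rpow this (hq x hx) hσ.le)
    _ = ENNReal.ofReal (q ^ σ) * ν (Deformed.val '' (Deformed.val ⁻¹' T :
          Set (DeformedSpace hν b m₀ hσ))) := by
        rw [setLIntegral_const, Deformed.measurableEmbedding_val.comap_apply]
    _ ≤ _ := by
        gcongr
        exact Set.image_preimage_subset _ _

theorem le_deformedVolume {S : Set (DeformedSpace hν b m₀ hσ)} {T : Set Z} {q : ℝ}
    (hT : MeasurableSet T) (hq0 : 0 ≤ q) (hST : ∀ z ∈ T, ∃ x ∈ S, x.val = z ∧ q ≤ ω (τ z)) :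
    ENNReal.ofReal (q ^ σ) * ν T ≤ deformedVolume hν b m₀ hσ S := by
  have hm : MeasurableSet (Deformed.val ⁻¹' T : Set (DeformedSpace hν b m₀ hσ)) :=
    Deformed.measurableEmbedding_val.measurable hT
  calc ENNReal.ofReal (q ^ σ) * ν T
      ≤ ENNReal.ofReal (q ^ σ) * ν (Deformed.val '' (Deformed.val ⁻¹' T :
          Set (DeformedSpace hν b m₀ hσ))) := by
        gcongr
        intro z hz
        obtain ⟨x, _, rfl, _⟩ := hST z hz
        exact ⟨x, hz, rfl⟩
    _ = ∫⁻ _ in Deformed.val ⁻¹' T, ENNReal.ofReal (q ^ σ) ∂(ν.comap Deformed.val) := by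
        rw [setLIntegral_const, Deformed.measurableEmbedding_val.comap_apply]
    _ ≤ ∫⁻ x in Deformed.val ⁻¹' T, specialDensity hν b m₀ hσ (nndist x.val b) ^ σ
          ∂(ν.comap Deformed.val) := by
        refine setLIntegral_mono' hm fun x hx => ?_
        rw [specialDensity_rpow]
        obtain ⟨_, _, _, h⟩ := hST _ hx
        exact ENNReal.ofReal_le_ofReal (Real.rpow_le_rpow hq0 h hσ.le)
    _ = deformedVolume hν b m₀ hσ (Deformed.val ⁻¹' T) := (withDensity_apply _ hm).symm
    _ ≤ _ := measure_mono fun x hx => by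
        obtain ⟨y, hy, hyx, _⟩ := hST _ hx
        rwa [← Deformed.val_injective _ _ hyx]

omit [BorelSpace Z] in
theorem measure_ball_eq_ofReal (hν : IsDoublingWith ν C) (x : Z) (r : ℝ) :
    ν (ball x r) = ENNReal.ofReal (ν.real (ball x r)) :=
  (ENNReal.ofReal_toReal (hν.measure_ball_lt_top x r).ne).symm

/-- The total mass far away from the base point is controlled by a power of the radius. -/
theorem deformedVolume_tail_le {T : ℝ} (hT : 0 < T) :
    deformedVolume hν b m₀ hσ {x | T ≤ τ x.val} ≤
      ENNReal.ofReal (C * (1 - 2 ^ (-σ))⁻¹ * T ^ (-σ)) := by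
  have hlt1 : (2 : ℝ) ^ (-σ) < 1 :=
    Real.rpow_lt_one_of_one_lt_of_neg one_lt_two (by linarith)
  have hpos1 : 0 < (2 : ℝ) ^ (-σ) := by positivity
  have hsub : {x : DeformedSpace hν b m₀ hσ | T ≤ τ x.val} ⊆
      ⋃ k : ℕ, {x | 2 ^ k * T ≤ τ x.val ∧ τ x.val < 2 * (2 ^ k * T)} := by
    intro x hx
    obtain ⟨k, hk1, hk2⟩ := exists_nat_pow_near (one_le_div hT |>.2 hx) one_lt_two
    refine Set.mem_iUnion.2 ⟨k, (le_div_iff₀ hT).1 hk1, ?_⟩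
    have := (div_lt_iff₀ hT).1 hk2
    rw [pow_succ] at this
    linarith
  have hshell : ∀ k : ℕ, deformedVolume hν b m₀ hσ
      {x | 2 ^ k * T ≤ τ x.val ∧ τ x.val < 2 * (2 ^ k * T)} ≤
        ENNReal.ofReal (C * T ^ (-σ) * (2 ^ (-σ)) ^ k) := by
    intro k
    set s := 2 ^ k * T with hs
    have hs0 : 0 < s := by positivity
    have hw := volumeWeight_pos (σ := σ) hν b hs0
    have hτ : Measurable τ := by
      unfold shiftedRadius
      fun_prop
    refine (deformedVolume_le (T := {z | s ≤ τ z} ∩ ball b (2 * s)) (q := ω s)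
      ((measurableSet_le measurable_const hτ).inter measurableSet_ball) ?_ ?_).trans ?_
    · intro x hx
      exact ⟨hx.1, mem_ball.2 ((dist_le_shiftedRadius b m₀ _).trans_lt hx.2)⟩
    · intro x hx
      exact volumeWeight_anti hν hσ b hs0 hx.1
    · calc ENNReal.ofReal (ω s ^ σ) * ν ({z | s ≤ τ z} ∩ ball b (2 * s))
          ≤ ENNReal.ofReal (ω s ^ σ) * ν (ball b (2 * s)) := by
            gcongr
            exact Set.inter_subset_right
        _ = ENNReal.ofReal (ω s ^ σ * ν.real (ball b (2 * s))) := by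
            rw [measure_ball_eq_ofReal hν, ENNReal.ofReal_mul (by positivity)]
        -- Doubling from 2s down to s meets the normalization: each shell has mass at most C s^{-σ},
        -- a geometric sequence in k.
        _ ≤ ENNReal.ofReal (ω s ^ σ * (C * ν.real (ball b s))) := by
            have := hν.real_ball_two_mul b hs0
            gcongr
        _ = _ := by
            have h1 := volumeWeight_rpow hν hσ b hs0
            have h2 : s ^ (-σ) = T ^ (-σ) * (2 ^ (-σ)) ^ k := by
              rw [hs, Real.mul_rpow (by positivity) hT.le, ← Real.rpow_natCast,
                ← Real.rpow_natCast, ← Real.rpow_mul (by norm_num), ← Real.rpow_mul (by norm_num)]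
              ring_nf
            congr 1
            rw [mul_left_comm, h1, h2]
            ring
  calc deformedVolume hν b m₀ hσ {x | T ≤ τ x.val}
      ≤ ∑' k : ℕ, ENNReal.ofReal (C * T ^ (-σ) * (2 ^ (-σ)) ^ k) :=
        (measure_mono hsub).trans ((measure_iUnion_le _).trans (ENNReal.tsum_le_tsum hshell))
    _ = ENNReal.ofReal (∑' k : ℕ, C * T ^ (-σ) * (2 ^ (-σ)) ^ k) :=
        (ENNReal.ofReal_tsum_of_nonneg (fun k => by positivity)
          ((summable_geometric_of_lt_one hpos1.le hlt1).mul_left _)).symm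
    _ = _ := by
        rw [tsum_mul_left, tsum_geometric_of_lt_one hpos1.le hlt1]
        ring_nf

/-- Upper bound for the measure of small balls. -/
theorem deformedVolume_ball_le (x : DeformedSpace hν b m₀ hσ) {r : ℝ}
    (hr : weightRatio C σ * r ≤ γ (τ x.val) / 2) :
    deformedVolume hν b m₀ hσ (ball x r) ≤ ENNReal.ofReal ((weightRatio C σ * ω (τ x.val)) ^ σ *
      ν.real (ball x.val (weightRatio C σ * r / ω (τ x.val)))) := by
  have hx := x.shiftedRadius_pos
  have hw := volumeWeight_pos (σ := σ) hν b hx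
  have ha := two_le_weightRatio hν hσ
  -- The second ball, of radius τ(x)/2, is there only to keep the weight comparable to its value at
  -- x.
  refine (deformedVolume_le (T := ball x.val (weightRatio C σ * r / ω (τ x.val)) ∩
    ball x.val (τ x.val / 2)) (q := weightRatio C σ * ω (τ x.val))
    (measurableSet_ball.inter measurableSet_ball) ?_ ?_).trans ?_
  · intro y hy
    have := x.dist_lt_of_dist_lt y hr (by rw [dist_comm]; exact hy)
    rw [dist_comm] at this
    exact this
  · intro y hy
    exact (volumeWeight_comparable hν hσ hx (by rw [dist_comm]; exact (mem_ball.1 hy.2).le)).2.1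
  · rw [ENNReal.ofReal_mul (by positivity), ← measure_ball_eq_ofReal hν]
    gcongr
    exact Set.inter_subset_left

/-- Lower bound for the measure of balls. -/
theorem le_deformedVolume_ball (x : DeformedSpace hν b m₀ hσ) {r s : ℝ}
    (hs : s ≤ τ x.val / 2) (hr : (1 + weightRatio C σ) * ω (τ x.val) * s ≤ r) :
    ENNReal.ofReal ((ω (τ x.val) / weightRatio C σ) ^ σ * ν.real (ball x.val s)) ≤
      deformedVolume hν b m₀ hσ (ball x r) := by
  have hx := x.shiftedRadius_pos
  have hw := volumeWeight_pos (σ := σ) hν b hx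
  have ha := two_le_weightRatio hν hσ
  have ha0 : 0 < weightRatio C σ := by linarith
  rw [ENNReal.ofReal_mul (by positivity), ← measure_ball_eq_ofReal hν]
  refine le_deformedVolume measurableSet_ball (by positivity) fun z hz => ?_
  rw [mem_ball, dist_comm] at hz
  obtain ⟨hz0, _, hz2⟩ := volumeWeight_comparable hν hσ hx (hz.le.trans hs)
  obtain ⟨y, rfl⟩ := Deformed.exists_val_eq (hν := hν) (hσ := hσ) hz0
  refine ⟨y, ?_, rfl, by rwa [div_le_iff₀ ha0, mul_comm]⟩
  rw [mem_ball, dist_comm]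
  refine (x.dist_le_of_dist_le y (hz.le.trans hs)).trans_lt (lt_of_lt_of_le ?_ hr)
  gcongr

end Measure

/-! ### Balls whose radius exceeds the gauge at the center. -/

section LargeBalls

variable {Z : Type*} [MetricSpace Z] [MeasurableSpace Z] [BorelSpace Z]
  {ν : Measure Z} {C : ℝ≥0} {hν : IsDoublingWith ν C} {b : Z} {m₀ : ℝ≥0} {σ κ : ℝ}
  {hσ : 0 < σ}

local notation "τ" => shiftedRadius b m₀
local notation "γ" => volumeGauge ν b σ
local notation "ω" => volumeWeight ν b σ

/-- The constant in the lower bound for the measure of balls whose radius is at least `l` times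
the gauge at the center. -/
noncomputable def largeBallConst (C : ℝ≥0) (σ l : ℝ) : ℝ :=
  (weightRatio C σ ^ σ * growthFactor C (2 / min (1 / 2) (l / (1 + weightRatio C σ))))⁻¹

omit [BorelSpace Z] in
theorem largeBallConst_pos (hν : IsDoublingWith ν C) (hσ : 0 < σ) (l : ℝ) :
    0 < largeBallConst C σ l := by
  have ha := two_le_weightRatio hν hσ
  have := hν.growthFactor_pos (2 / min (1 / 2) (l / (1 + weightRatio C σ)))
  unfold largeBallConst
  positivity

/-- Such a ball contains a d-ball about x of radius ητ(x), whose ν-mass is a fixed fraction of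
ν(B(b,τ(x))); the normalization turns this into τ(x)^{-σ}. Here η ≤ 1/2 controls the weight and
(1+a)η ≤ l, with a = `weightRatio C σ`, keeps the d-ball inside. -/
theorem le_deformedVolume_ball_of_gauge_le (x : DeformedSpace hν b m₀ hσ) {l r : ℝ} (hl : 0 < l)
    (hr : l * γ (τ x.val) ≤ r) :
    ENNReal.ofReal (largeBallConst C σ l * τ x.val ^ (-σ)) ≤
      deformedVolume hν b m₀ hσ (ball x r) := by
  have hx := x.shiftedRadius_pos
  have hw := volumeWeight_pos (σ := σ) hν b hx
  have hg := volumeGauge_pos (σ := σ) hν b hx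
  have ha := two_le_weightRatio hν hσ
  have ha0 : 0 < weightRatio C σ := by linarith
  have hq : 0 < l / (1 + weightRatio C σ) := by positivity
  set η := min (1 / 2) (l / (1 + weightRatio C σ)) with hη
  have hη0 : 0 < η := lt_min (by norm_num) hq
  have hη1 : η ≤ 1 / 2 := min_le_left _ _
  have hη2 : (1 + weightRatio C σ) * η ≤ l := by
    rw [← le_div_iff₀' (by positivity)]
    exact min_le_right _ _
  refine le_trans (ENNReal.ofReal_le_ofReal ?_) (le_deformedVolume_ball x (s := η * τ x.val)
    (by nlinarith) ?_)
  · have hD := hν.growthFactor_pos (2 / η)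
    have h1 : ν.real (ball b (τ x.val)) ≤
        growthFactor C (2 / η) * ν.real (ball x.val (η * τ x.val)) := by
      refine hν.real_ball_le (by positivity) (ball_subset_ball' ?_)
      have e : 2 / η * (η * τ x.val) = 2 * τ x.val := by field_simp
      rw [e, dist_comm]
      linarith [dist_le_shiftedRadius b m₀ x.val]
    rw [← volumeWeight_rpow hν hσ b hx, Real.div_rpow hw.le ha0.le]
    unfold largeBallConst
    rw [← hη]
    calc _ ≤ (weightRatio C σ ^ σ * growthFactor C (2 / η))⁻¹ * (ω (τ x.val) ^ σ *
          (growthFactor C (2 / η) * ν.real (ball x.val (η * τ x.val)))) := by gcongr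
      _ = _ := by field_simp
  · calc (1 + weightRatio C σ) * ω (τ x.val) * (η * τ x.val)
        = ((1 + weightRatio C σ) * η) * (ω (τ x.val) * τ x.val) := by ring
      _ ≤ l * γ (τ x.val) := by
        rw [volumeWeight_mul_self ν b σ hx]
        gcongr
      _ ≤ r := hr

/-- The constant in the upper bound for the mass far away from the base point. -/
noncomputable def tailConst (C : ℝ≥0) (σ : ℝ) : ℝ := C * (1 - 2 ^ (-σ))⁻¹

omit [BorelSpace Z] in
theorem tailConst_pos (hν : IsDoublingWith ν C) (hσ : 0 < σ) : 0 < tailConst C σ := by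
  have h : (0 : ℝ) < C := by exact_mod_cast lt_trans zero_lt_one hν.one_lt
  have hlt1 : (2 : ℝ) ^ (-σ) < 1 :=
    Real.rpow_lt_one_of_one_lt_of_neg one_lt_two (by linarith)
  have : 0 < 1 - (2 : ℝ) ^ (-σ) := by linarith
  unfold tailConst
  positivity

theorem deformedVolume_ball_le_of_forall (x : DeformedSpace hν b m₀ hσ) {r R Q : ℝ}
    (hR : 0 < R) (hQ : 0 < Q) (h : ∀ y ∈ ball x r, R ≤ Q * τ y.val) :
    deformedVolume hν b m₀ hσ (ball x r) ≤ ENNReal.ofReal (tailConst C σ * Q ^ σ * R ^ (-σ)) := by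
  refine (measure_mono fun y hy => ?_).trans ((deformedVolume_tail_le (T := R / Q)
    (by positivity)).trans (ENNReal.ofReal_le_ofReal (le_of_eq ?_)))
  · exact (div_le_iff₀' hQ).2 (h y hy)
  · rw [Real.div_rpow hR.le hQ.le, Real.rpow_neg hQ.le]
    unfold tailConst
    field_simp

omit [BorelSpace Z] in
-- Large balls cannot come too close to b. If y is d-far from x relative to τ(y), then reaching x
-- costs at least a multiple of γ(τ(y)); otherwise τ(x) ≤ 2τ(y) and the two gauges compare.
theorem volumeGauge_le_of_mem_ball {x y : DeformedSpace hν b m₀ hσ} {l r : ℝ}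
    (hy : y ∈ ball x r) (hl : 0 ≤ l) (hx : γ (τ x.val) ≤ l * r) :
    γ (τ y.val) ≤ (2 * weightRatio C σ + weightRatio C σ * l) * r := by
  have hy0 := y.shiftedRadius_pos
  have hw := volumeWeight_pos (σ := σ) hν b hy0
  have ha := two_le_weightRatio hν hσ
  have hr : 0 < r := dist_nonneg.trans_lt (mem_ball.1 hy)
  have h1 := y.le_dist x
  have h2 : weightRatio C σ * dist y x ≤ weightRatio C σ * r := by
    have := (mem_ball.1 hy).le
    gcongr
  have h3 : 0 ≤ weightRatio C σ * l * r := by positivity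
  rcases le_or_gt (τ y.val / 2) (dist y.val x.val) with h | h
  · have h4 : ω (τ y.val) * (τ y.val / 2) ≤ ω (τ y.val) * min (dist y.val x.val) (τ y.val) := by
      have := le_min h (by linarith : τ y.val / 2 ≤ τ y.val)
      gcongr
    rw [← volumeWeight_mul_self ν b σ hy0]
    nlinarith
  · have h4 := shiftedRadius_le_add b m₀ y.val x.val
    have h5 := volumeGauge_le hν hσ b hy0 x.shiftedRadius_pos (by linarith)
    have h6 : weightRatio C σ / 2 * γ (τ x.val) ≤ weightRatio C σ / 2 * (l * r) := by gcongr
    nlinarith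

end LargeBalls

/-! ### Doubling of the deformed measure. -/

section Doubling

/-- The distance to points farther away from the base point is bounded by the gauge. -/
def GaugeBound {Z : Type*} [MetricSpace Z] [MeasurableSpace Z]
    {ν : Measure Z} {C : ℝ≥0} (hν : IsDoublingWith ν C) (b : Z) (m₀ : ℝ≥0) {σ : ℝ}
    (hσ : 0 < σ) (M : ℝ) : Prop :=
  ∀ x y : DeformedSpace hν b m₀ hσ, shiftedRadius b m₀ x.val ≤ shiftedRadius b m₀ y.val →
    dist x y ≤ M * volumeGauge ν b σ (shiftedRadius b m₀ x.val)

variable {Z : Type*} [MetricSpace Z] [MeasurableSpace Z] [BorelSpace Z]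
  {ν : Measure Z} {C : ℝ≥0} {hν : IsDoublingWith ν C} {b : Z} {m₀ : ℝ≥0} {σ κ : ℝ}
  {hσ : 0 < σ}

local notation "τ" => shiftedRadius b m₀
local notation "γ" => volumeGauge ν b σ
local notation "ω" => volumeWeight ν b σ

/-- Both balls are squeezed between d-balls about x with comparable radii and nearly constant
weight. The intermediate real L yields positivity, finiteness and doubling together in
`isDoublingWith_of_bounds`. -/
theorem deformedVolume_doubling_small (x : DeformedSpace hν b m₀ hσ) {r : ℝ} (hr0 : 0 < r)
    (hr : weightRatio C σ * (2 * r) ≤ γ (τ x.val) / 2) :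
    ∃ L : ℝ, 0 < L ∧ deformedVolume hν b m₀ hσ (ball x (2 * r)) ≤
        ENNReal.ofReal ((weightRatio C σ ^ 2) ^ σ *
          growthFactor C (2 * weightRatio C σ * (1 + weightRatio C σ)) * L) ∧
      ENNReal.ofReal L ≤ deformedVolume hν b m₀ hσ (ball x r) := by
  have hx := x.shiftedRadius_pos
  have hw := volumeWeight_pos (σ := σ) hν b hx
  have ha := two_le_weightRatio hν hσ
  have ha0 : 0 < weightRatio C σ := by linarith
  set s := r / ((1 + weightRatio C σ) * ω (τ x.val)) with hs
  have hs0 : 0 < s := by positivity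
  have hV := hν.real_ball_pos x.val hs0
  refine ⟨(ω (τ x.val) / weightRatio C σ) ^ σ * ν.real (ball x.val s), by positivity,
    (deformedVolume_ball_le x hr).trans (ENNReal.ofReal_le_ofReal ?_),
    le_deformedVolume_ball x ?_ ?_⟩
  · have h1 : ν.real (ball x.val (weightRatio C σ * (2 * r) / ω (τ x.val))) ≤
        growthFactor C (2 * weightRatio C σ * (1 + weightRatio C σ)) * ν.real (ball x.val s) := by
      refine hν.real_ball_le_of_le x.val hs0 (le_of_eq ?_)
      rw [hs]
      field_simp
    have h2 : (weightRatio C σ * ω (τ x.val)) ^ σ =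
        (weightRatio C σ ^ 2) ^ σ * (ω (τ x.val) / weightRatio C σ) ^ σ := by
      rw [← Real.mul_rpow (by positivity) (by positivity)]
      congr 1
      field_simp
    calc _ ≤ (weightRatio C σ * ω (τ x.val)) ^ σ *
          (growthFactor C (2 * weightRatio C σ * (1 + weightRatio C σ)) *
            ν.real (ball x.val s)) := by gcongr
      _ = _ := by rw [h2]; ring
  · rw [hs, div_le_iff₀ (by positivity)]
    rw [← volumeWeight_mul_self ν b σ hx] at hr
    have : 0 < ω (τ x.val) * τ x.val := by positivity
    nlinarith
  · rw [hs]
    field_simp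
    rfl

omit [BorelSpace Z] in
-- A bound on the gauge keeps τ away from zero on the ball: otherwise gauge decay, read inward from
-- x, would make γ too large. Hence the infimum of τ is positive and some point comes within a
-- factor two of it.
theorem exists_almost_minimal_radius (hdecay : ∀ q > 0, ∃ K, 2 ≤ K ∧ GaugeDecay ν b m₀ σ q K)
    (x : DeformedSpace hν b m₀ hσ) {r l : ℝ} (hr : 0 < r)
    (hl : ∀ y ∈ ball x r, γ (τ y.val) ≤ l) :
    ∃ y ∈ ball x r, ∀ z ∈ ball x r, τ y.val ≤ 2 * τ z.val := by
  have hx := x.shiftedRadius_pos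
  have hg := volumeGauge_pos (σ := σ) hν b hx
  have hxl := hl x (mem_ball_self hr)
  have hl0 : 0 < l := by linarith
  -- This K depends on x and l, which is harmless: it enters no constant.
  obtain ⟨K, hK, hKd⟩ := hdecay (2 * l / γ (τ x.val)) (by positivity)
  have hlow : ∀ y ∈ ball x r, τ x.val / K ≤ τ y.val := by
    intro y hy
    by_contra! hc
    rw [lt_div_iff₀' (by positivity)] at hc
    have h1 := hKd x.val y.val y.shiftedRadius_pos hc.le
    rw [div_mul_cancel₀ _ hg.ne'] at h1
    linarith [hl y hy]
  set S := (fun y : DeformedSpace hν b m₀ hσ => τ y.val) '' ball x r with hS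
  have hne : S.Nonempty := ⟨_, x, mem_ball_self hr, rfl⟩
  have hbdd : BddBelow S := ⟨τ x.val / K, by rintro _ ⟨y, hy, rfl⟩; exact hlow y hy⟩
  have hpos : 0 < sInf S := lt_of_lt_of_le (by positivity : 0 < τ x.val / K)
    (le_csInf hne (by rintro _ ⟨y, hy, rfl⟩; exact hlow y hy))
  obtain ⟨_, ⟨y, hy, rfl⟩, hlt⟩ := exists_lt_of_csInf_lt hne (by linarith : sInf S < 2 * sInf S)
  refine ⟨y, hy, fun z hz => hlt.le.trans ?_⟩
  have := csInf_le hbdd ⟨z, hz, rfl⟩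
  linarith

/-- With y of almost minimal τ in the double ball, that ball lies in {τ ≥ τ(y)/2} and has mass at
most a multiple of τ(y)^{-σ}. The smaller ball must carry as much: it contains a large ball about
some w with τ(w) at most (1+κK)τ(y), either x itself or a point found by uniform perfectness. -/
theorem deformedVolume_doubling_large (hb : UniformlyPerfectAt b m₀ κ)
    (hdecay : ∀ q > 0, ∃ K, 2 ≤ K ∧ GaugeDecay ν b m₀ σ q K)
    {M K : ℝ} (hM : 1 ≤ M) (hbound : GaugeBound hν b m₀ hσ M) (hK : 2 ≤ K)
    (hKd : GaugeDecay ν b m₀ σ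
      (2 * M * ((2 * weightRatio C σ + weightRatio C σ * (2 * weightRatio C σ)) * 2)) K)
    (x : DeformedSpace hν b m₀ hσ) {r : ℝ} (hr0 : 0 < r)
    (hr : γ (τ x.val) / 2 < weightRatio C σ * (2 * r)) :
    ∃ L : ℝ, 0 < L ∧ deformedVolume hν b m₀ hσ (ball x (2 * r)) ≤
        ENNReal.ofReal (tailConst C σ * (2 * (1 + κ * K)) ^ σ *
          (largeBallConst C σ (1 / (4 * weightRatio C σ)))⁻¹ * L) ∧
      ENNReal.ofReal L ≤ deformedVolume hν b m₀ hσ (ball x r) := by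
  have hx := x.shiftedRadius_pos
  have hgx := volumeGauge_pos (σ := σ) hν b hx
  have ha := two_le_weightRatio hν hσ
  have ha0 : 0 < weightRatio C σ := by linarith
  have hκ := hb.one_lt
  set a := weightRatio C σ with had
  set q := 2 * a + a * (2 * a) with hq
  have hq0 : 0 < q := by positivity
  have hgauge : ∀ y ∈ ball x (2 * r), γ (τ y.val) ≤ q * (2 * r) := fun y hy =>
    volumeGauge_le_of_mem_ball hy (by positivity) (by linarith)
  obtain ⟨y, hy, hmin⟩ := exists_almost_minimal_radius hdecay x (by positivity) hgauge
  have hy0 := y.shiftedRadius_pos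
  have hgy := hgauge y hy
  have hc := largeBallConst_pos hν hσ (1 / (4 * a))
  obtain ⟨w, hwy, hw⟩ : ∃ w : DeformedSpace hν b m₀ hσ, τ w.val ≤ (1 + κ * K) * τ y.val ∧
      ENNReal.ofReal (largeBallConst C σ (1 / (4 * a)) * τ w.val ^ (-σ)) ≤
        deformedVolume hν b m₀ hσ (ball x r) := by
    rcases le_or_gt (τ x.val) ((1 + κ * K) * τ y.val) with hxy | hxy
    · refine ⟨x, hxy, le_deformedVolume_ball_of_gauge_le x (by positivity) ?_⟩
      rw [one_div_mul_eq_div, div_le_iff₀ (by positivity)]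
      linarith
    · have hm := le_shiftedRadius b m₀ y.val
      have hm0 : (0 : ℝ) ≤ m₀ := m₀.2
      have hxb : κ * K * τ y.val ≤ dist x.val b := by
        have : τ x.val = dist x.val b + m₀ := rfl
        linarith
      have hKy : 0 < K * τ y.val := by positivity
      have hKy1 : K * τ y.val ≤ κ * (K * τ y.val) := by nlinarith
      obtain ⟨z₀, hz1, hz2⟩ := hb.exists_mem hKy (by nlinarith) (x := x.val) (by linarith)
      have hzτ : τ z₀ = dist z₀ b + m₀ := rfl
      obtain ⟨z, rfl⟩ := Deformed.exists_val_eq (hν := hν) (hσ := hσ) (b := b) (m₀ := m₀)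
        (z := z₀) (by linarith)
      have hz0 := z.shiftedRadius_pos
      have hgz := volumeGauge_pos (σ := σ) hν b hz0
      have h1 := hKd z.val y.val hy0 (by linarith)
      have h2 := hKd x.val y.val hy0 (by linarith [dist_le_shiftedRadius b m₀ x.val])
      -- The decay factor 2M·(2q) is made for this: γ(τ(y)) ≤ 2qr, so γ at z, and likewise at x, is
      -- at most r/(2M), and then d̂(x,z) ≤ r/2.
      have h1' : M * γ (τ z.val) ≤ r / 2 := by
        have : (q * 2) * (2 * (M * γ (τ z.val))) ≤ (q * 2) * r := by linarith
        linarith [le_of_mul_le_mul_left this (by positivity)]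
      have h2' : M * γ (τ x.val) ≤ r / 2 := by
        have : (q * 2) * (2 * (M * γ (τ x.val))) ≤ (q * 2) * r := by linarith
        linarith [le_of_mul_le_mul_left this (by positivity)]
      have hd : dist x z ≤ r / 2 := by
        rcases le_total (τ x.val) (τ z.val) with h | h
        · exact (hbound x z h).trans h2'
        · rw [dist_comm]
          exact (hbound z x h).trans h1'
      refine ⟨z, by linarith, le_trans (le_deformedVolume_ball_of_gauge_le z (r := r / 2)
        (by positivity) ?_) (measure_mono (ball_subset_ball' (by rw [dist_comm]; linarith)))⟩
      refine le_trans ?_ h1'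
      have : 1 / (4 * a) ≤ M := by
        rw [div_le_iff₀ (by positivity)]
        nlinarith
      gcongr
  have hw0 := w.shiftedRadius_pos
  refine ⟨_, mul_pos hc (Real.rpow_pos_of_pos hw0 (-σ)), ?_, hw⟩
  refine (deformedVolume_ball_le_of_forall x (R := τ w.val) (Q := 2 * (1 + κ * K)) hw0
    (by positivity) fun z hz => ?_).trans (ENNReal.ofReal_le_ofReal (le_of_eq ?_))
  · have h1 := hmin z hz
    calc τ w.val ≤ (1 + κ * K) * τ y.val := hwy
      _ ≤ (1 + κ * K) * (2 * τ z.val) := by gcongr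
      _ = _ := by ring
  · field_simp

/-- The doubling constant on the deformed space. -/
noncomputable def deformedDoublingConst (C : ℝ≥0) (σ κ K : ℝ) : ℝ :=
  (weightRatio C σ ^ 2) ^ σ * growthFactor C (2 * weightRatio C σ * (1 + weightRatio C σ)) +
    tailConst C σ * (2 * (1 + κ * K)) ^ σ *
      (largeBallConst C σ (1 / (4 * weightRatio C σ)))⁻¹ + 2

theorem isDoublingWith_of_bounds {X : Type*} [PseudoMetricSpace X] [MeasurableSpace X]
    {μ : Measure X} {A : ℝ} (hA : 1 < A)
    (h : ∀ (x : X) (r : ℝ), 0 < r → ∃ L : ℝ, 0 < L ∧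
      μ (ball x (2 * r)) ≤ ENNReal.ofReal (A * L) ∧ ENNReal.ofReal L ≤ μ (ball x r)) :
    IsDoublingWith μ A.toNNReal where
  one_lt := by simpa using hA
  pos x r hr := by
    obtain ⟨L, hL, _, h2⟩ := h x (2 * r) (by positivity)
    exact (ENNReal.ofReal_pos.2 hL).trans_le h2
  doubling x r hr := by
    obtain ⟨L, hL, h1, h2⟩ := h x r hr
    rw [ENNReal.ofReal_mul (by linarith)] at h1
    exact h1.trans (mul_le_mul_right h2 _)
  finite x r hr := by
    obtain ⟨L, hL, h1, h2⟩ := h x r hr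
    exact (measure_mono (ball_subset_ball (by linarith))).trans_lt
      (h1.trans_lt ENNReal.ofReal_lt_top)

theorem isDoublingWith_deformedVolume (hb : UniformlyPerfectAt b m₀ κ)
    (hdecay : ∀ q > 0, ∃ K, 2 ≤ K ∧ GaugeDecay ν b m₀ σ q K)
    {M K : ℝ} (hM : 1 ≤ M) (hbound : GaugeBound hν b m₀ hσ M) (hK : 2 ≤ K)
    (hKd : GaugeDecay ν b m₀ σ
      (2 * M * ((2 * weightRatio C σ + weightRatio C σ * (2 * weightRatio C σ)) * 2)) K) :
    IsDoublingWith (deformedVolume hν b m₀ hσ) (deformedDoublingConst C σ κ K).toNNReal := by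
  have ha := two_le_weightRatio hν hσ
  have hκ := hb.one_lt
  have hc := largeBallConst_pos hν hσ (1 / (4 * weightRatio C σ))
  have ht := tailConst_pos hν hσ
  have hD := hν.growthFactor_pos (2 * weightRatio C σ * (1 + weightRatio C σ))
  have h1 : 0 ≤ (weightRatio C σ ^ 2) ^ σ *
      growthFactor C (2 * weightRatio C σ * (1 + weightRatio C σ)) := by positivity
  have h2 : 0 ≤ tailConst C σ * (2 * (1 + κ * K)) ^ σ *
      (largeBallConst C σ (1 / (4 * weightRatio C σ)))⁻¹ := by positivity
  refine isDoublingWith_of_bounds (by unfold deformedDoublingConst; linarith) fun x r hr => ?_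
  rcases le_or_gt (weightRatio C σ * (2 * r)) (γ (τ x.val) / 2) with h | h
  · obtain ⟨L, hL, h3, h4⟩ := deformedVolume_doubling_small x hr h
    refine ⟨L, hL, h3.trans (ENNReal.ofReal_le_ofReal ?_), h4⟩
    unfold deformedDoublingConst
    gcongr
    linarith
  · obtain ⟨L, hL, h3, h4⟩ := deformedVolume_doubling_large hb hdecay hM hbound hK hKd x hr h
    refine ⟨L, hL, h3.trans (ENNReal.ofReal_le_ofReal ?_), h4⟩
    unfold deformedDoublingConst
    gcongr
    linarith

end Doubling

/-! ### Pointwise comparison of the energy kernels. -/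

section Kernel

variable {Z : Type*} [MetricSpace Z] [MeasurableSpace Z] [BorelSpace Z]
  {ν : Measure Z} {C : ℝ≥0} {hν : IsDoublingWith ν C} {b : Z} {m₀ : ℝ≥0} {σ κ : ℝ}
  {hσ : 0 < σ}

local notation "τ" => shiftedRadius b m₀
local notation "γ" => volumeGauge ν b σ
local notation "ω" => volumeWeight ν b σ

/-- The kernel `(ρ(x) ρ(y) d(x,y))^σ ν(B(x, d(x,y)))` of the original space. -/
noncomputable def weightedKernel (x y : DeformedSpace hν b m₀ hσ) : ℝ :=
  (ω (τ x.val) * ω (τ y.val) * dist x.val y.val) ^ σ *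
    ν.real (ball x.val (dist x.val y.val))

/-- The kernel `d̂(x,y)^σ ν̂(B̂(x, d̂(x,y)))` of the deformed space. -/
noncomputable def deformedKernel (x y : DeformedSpace hν b m₀ hσ) : ℝ :=
  dist x y ^ σ * (deformedVolume hν b m₀ hσ).real (ball x (dist x y))

omit [BorelSpace Z] in
theorem Deformed.dist_val_pos {x y : DeformedSpace hν b m₀ hσ} (h : x ≠ y) :
    0 < dist x.val y.val :=
  dist_pos.2 fun he => h (Deformed.val_injective _ _ he)

theorem real_le_of_le_ofReal {X : Type*} [MeasurableSpace X] {μ : Measure X} {S : Set X} {q : ℝ}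
    (hq : 0 ≤ q) (h : μ S ≤ ENNReal.ofReal q) : μ.real S ≤ q :=
  ENNReal.toReal_le_of_le_ofReal hq h

theorem le_real_of_ofReal_le {X : Type*} [MeasurableSpace X] {μ : Measure X} {S : Set X} {q : ℝ}
    (hS : μ S ≠ ⊤) (h : ENNReal.ofReal q ≤ μ S) : q ≤ μ.real S :=
  (ENNReal.ofReal_le_iff_le_toReal hS).1 h

/-- Here d̂ is comparable to ω(τ(x))d and the two weights are comparable. The threshold τ(x)/(4a), a
= `weightRatio C σ`, puts the radius d̂(x,y) in the small-ball regime. Finiteness matters because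
`Measure.real` sends infinite mass to 0. -/
theorem deformedKernel_near {x y : DeformedSpace hν b m₀ hσ} (hxy : x ≠ y)
    (hle : τ x.val ≤ τ y.val)
    (hd : dist x.val y.val ≤ τ x.val / (4 * weightRatio C σ))
    (hfin : deformedVolume hν b m₀ hσ (ball x (dist x y)) ≠ ⊤) :
    deformedKernel x y ≤ (2 * weightRatio C σ ^ 2) ^ σ * growthFactor C (2 * weightRatio C σ) *
        weightedKernel x y ∧
      weightedKernel x y ≤ (weightRatio C σ ^ 3) ^ σ *
        growthFactor C (weightRatio C σ * (1 + weightRatio C σ)) * deformedKernel x y := by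
  have hx := x.shiftedRadius_pos
  have hy := y.shiftedRadius_pos
  have hwx := volumeWeight_pos (σ := σ) hν b hx
  have hwy := volumeWeight_pos (σ := σ) hν b hy
  have ha := two_le_weightRatio hν hσ
  have hd0 := Deformed.dist_val_pos hxy
  have hup := x.dist_le_of_le y hle
  have hlow := x.le_dist y
  unfold deformedKernel weightedKernel
  set a := weightRatio C σ
  set d := dist x.val y.val
  have ha0 : 0 < a := by linarith
  have hd4 : 4 * a * d ≤ τ x.val := by rwa [le_div_iff₀' (by positivity)] at hd
  have hdτ : d ≤ τ x.val / 2 := by nlinarith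
  rw [min_eq_left (by linarith)] at hlow
  have hw := (volumeWeight_comparable hν hσ hx hdτ).2.2
  have hdh : 0 ≤ dist x y := dist_nonneg
  have hV := hν.real_ball_pos x.val hd0
  have hD1 := hν.growthFactor_pos (2 * a)
  have hD2 := hν.growthFactor_pos (a * (1 + a))
  constructor
  · have h1 : (deformedVolume hν b m₀ hσ).real (ball x (dist x y)) ≤
        (a * ω (τ x.val)) ^ σ * (growthFactor C (2 * a) * ν.real (ball x.val d)) := by
      refine (real_le_of_le_ofReal (by positivity) (deformedVolume_ball_le x ?_)).trans ?_
      · rw [← volumeWeight_mul_self ν b σ hx]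
        have : a * dist x y ≤ a * (2 * ω (τ x.val) * d) := by gcongr
        have : ω (τ x.val) * (4 * a * d) ≤ ω (τ x.val) * τ x.val := by gcongr
        linarith
      · have : ν.real (ball x.val (a * dist x y / ω (τ x.val))) ≤
            growthFactor C (2 * a) * ν.real (ball x.val d) := by
          refine hν.real_ball_le_of_le x.val hd0 ?_
          rw [div_le_iff₀ hwx]
          have : a * dist x y ≤ a * (2 * ω (τ x.val) * d) := by gcongr
          linarith
        gcongr
    calc dist x y ^ σ * (deformedVolume hν b m₀ hσ).real (ball x (dist x y))
        ≤ (2 * ω (τ x.val) * d) ^ σ * ((a * ω (τ x.val)) ^ σ *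
          (growthFactor C (2 * a) * ν.real (ball x.val d))) := by gcongr
      _ = (2 * ω (τ x.val) * d * (a * ω (τ x.val))) ^ σ *
          (growthFactor C (2 * a) * ν.real (ball x.val d)) := by
        rw [Real.mul_rpow (x := 2 * ω (τ x.val) * d) (by positivity) (by positivity)]
        ring
      _ ≤ (2 * a ^ 2 * (ω (τ x.val) * ω (τ y.val) * d)) ^ σ *
          (growthFactor C (2 * a) * ν.real (ball x.val d)) := by
        refine mul_le_mul_of_nonneg_right (Real.rpow_le_rpow (by positivity) ?_ hσ.le)
          (by positivity)
        calc 2 * ω (τ x.val) * d * (a * ω (τ x.val))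
            ≤ 2 * ω (τ x.val) * d * (a * (a * ω (τ y.val))) := by gcongr
          _ = _ := by ring
      _ = _ := by
        rw [Real.mul_rpow (x := 2 * a ^ 2) (by positivity) (by positivity)]
        ring
  · set s := d / (a * (1 + a)) with hs
    have hs0 : 0 < s := by positivity
    have hVs := hν.real_ball_pos x.val hs0
    have hsd : s ≤ d := div_le_self hd0.le (by nlinarith)
    have h1 : (ω (τ x.val) / a) ^ σ * ν.real (ball x.val s) ≤
        (deformedVolume hν b m₀ hσ).real (ball x (dist x y)) := by
      refine le_real_of_ofReal_le hfin (le_deformedVolume_ball x (by linarith) ?_)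
      have : (1 + a) * ω (τ x.val) * s = ω (τ x.val) * d / a := by
        rw [hs]
        field_simp
      change (1 + a) * ω (τ x.val) * s ≤ _
      rw [this]
      rwa [div_le_iff₀' ha0]
    have h2 : ν.real (ball x.val d) ≤ growthFactor C (a * (1 + a)) * ν.real (ball x.val s) := by
      refine hν.real_ball_le_of_le x.val hs0 (le_of_eq ?_)
      rw [hs]
      field_simp
    have h3 : ω (τ x.val) * d / a ≤ dist x y := by rwa [div_le_iff₀' ha0]
    calc (ω (τ x.val) * ω (τ y.val) * d) ^ σ * ν.real (ball x.val d)
        ≤ (ω (τ x.val) * (a * ω (τ x.val)) * d) ^ σ *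
          (growthFactor C (a * (1 + a)) * ν.real (ball x.val s)) := by
          have := volumeWeight_anti hν hσ b hx hle
          have : ω (τ y.val) ≤ a * ω (τ x.val) := by nlinarith
          gcongr
      _ = (a ^ 3 * ((ω (τ x.val) * d / a) * (ω (τ x.val) / a))) ^ σ *
          (growthFactor C (a * (1 + a)) * ν.real (ball x.val s)) := by
        congr 2
        field_simp
      _ = (a ^ 3) ^ σ * growthFactor C (a * (1 + a)) * ((ω (τ x.val) * d / a) ^ σ *
          ((ω (τ x.val) / a) ^ σ * ν.real (ball x.val s))) := by
        rw [Real.mul_rpow (x := a ^ 3) (by positivity) (by positivity),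
          Real.mul_rpow (x := ω (τ x.val) * d / a) (by positivity) (by positivity)]
        ring
      _ ≤ _ := by gcongr

omit [BorelSpace Z] in
-- Now d is comparable to τ(y) and B(x,d) to B(b,τ(y)), so by the normalization all factors
-- involving y cancel.
theorem weightedKernel_far {x y : DeformedSpace hν b m₀ hσ}
    (hle : τ x.val ≤ τ y.val) {l : ℝ} (hl : 0 < l)
    (hd : τ x.val ≤ l * dist x.val y.val) :
    weightedKernel x y ≤ 2 ^ σ * growthFactor C (2 * (1 + l)) * ω (τ x.val) ^ σ ∧
      ω (τ x.val) ^ σ ≤ (1 + l) ^ σ * growthFactor C (1 + 2 * l) * weightedKernel x y := by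
  have hx := x.shiftedRadius_pos
  have hy := y.shiftedRadius_pos
  have hwx := volumeWeight_pos (σ := σ) hν b hx
  have hwy := volumeWeight_pos (σ := σ) hν b hy
  have hfy := hν.real_ball_pos b hy
  have h1 := dist_le_shiftedRadius_add b m₀ x.val y.val
  have h2 := shiftedRadius_le_add b m₀ x.val y.val
  have h3 := dist_le_shiftedRadius b m₀ x.val
  have hone := volumeWeight_rpow hν hσ b hy
  unfold weightedKernel
  set d := dist x.val y.val
  have hd0 : 0 < d := by by_contra! hc; nlinarith
  have hV := hν.real_ball_pos x.val hd0
  have hD1 := hν.growthFactor_pos (2 * (1 + l))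
  have hD2 := hν.growthFactor_pos (1 + 2 * l)
  have hone' : τ y.val ^ σ * (ω (τ y.val) ^ σ * ν.real (ball b (τ y.val))) = 1 := by
    rw [hone, Real.rpow_neg hy.le]
    exact mul_inv_cancel₀ (by positivity)
  constructor
  · have h4 : ν.real (ball x.val d) ≤
        growthFactor C (2 * (1 + l)) * ν.real (ball b (τ y.val)) := by
      refine hν.real_ball_le hy (ball_subset_ball' ?_)
      nlinarith
    calc (ω (τ x.val) * ω (τ y.val) * d) ^ σ * ν.real (ball x.val d)
        ≤ (ω (τ x.val) * ω (τ y.val) * (2 * τ y.val)) ^ σ *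
          (growthFactor C (2 * (1 + l)) * ν.real (ball b (τ y.val))) := by
          gcongr
          linarith
      _ = 2 ^ σ * growthFactor C (2 * (1 + l)) * ω (τ x.val) ^ σ *
          (τ y.val ^ σ * (ω (τ y.val) ^ σ * ν.real (ball b (τ y.val)))) := by
        rw [Real.mul_rpow (by positivity) (by positivity), Real.mul_rpow (by positivity)
          (by positivity), Real.mul_rpow (by positivity) (by positivity)]
        ring
      _ = _ := by rw [hone', mul_one]
  · have h4 : ν.real (ball b (τ y.val)) ≤
        growthFactor C (1 + 2 * l) * ν.real (ball x.val d) := by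
      refine hν.real_ball_le hd0 (ball_subset_ball' ?_)
      rw [dist_comm]
      nlinarith
    calc ω (τ x.val) ^ σ = ω (τ x.val) ^ σ *
          (τ y.val ^ σ * (ω (τ y.val) ^ σ * ν.real (ball b (τ y.val)))) := by rw [hone', mul_one]
      _ ≤ ω (τ x.val) ^ σ * (((1 + l) * d) ^ σ * (ω (τ y.val) ^ σ *
          (growthFactor C (1 + 2 * l) * ν.real (ball x.val d)))) := by
        gcongr
        linarith
      _ = _ := by
        rw [Real.mul_rpow (x := 1 + l) (by positivity) (by positivity), Real.mul_rpow
          (x := ω (τ x.val) * ω (τ y.val)) (by positivity)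
          (by positivity), Real.mul_rpow (by positivity) (by positivity)]
        ring

/-- Now d̂ is comparable to γ(τ(x)) and the ball has mass comparable to τ(x)^{-σ}; the product γ^σ
τ^{-σ} is ω^σ. -/
theorem deformedKernel_far {x y : DeformedSpace hν b m₀ hσ}
    (hle : τ x.val ≤ τ y.val)
    (hd : τ x.val ≤ 4 * weightRatio C σ * dist x.val y.val)
    (hfin : deformedVolume hν b m₀ hσ (ball x (dist x y)) ≠ ⊤)
    {M K : ℝ} (hM : 1 ≤ M) (hbound : GaugeBound hν b m₀ hσ M) (hK : 2 ≤ K)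
    (hKd : GaugeDecay ν b m₀ σ
      (2 * M * (2 * weightRatio C σ + weightRatio C σ * (4 * weightRatio C σ ^ 2))) K) :
    deformedKernel x y ≤ M ^ σ * tailConst C σ * K ^ σ * ω (τ x.val) ^ σ ∧
      ω (τ x.val) ^ σ ≤ (4 * weightRatio C σ ^ 2) ^ σ *
        (largeBallConst C σ (1 / (4 * weightRatio C σ ^ 2)))⁻¹ * deformedKernel x y := by
  have hx := x.shiftedRadius_pos
  have hwx := volumeWeight_pos (σ := σ) hν b hx
  have hgx := volumeGauge_pos (σ := σ) hν b hx
  have ha := two_le_weightRatio hν hσ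
  have hup := hbound x y hle
  have hlow := x.le_dist y
  have ht := tailConst_pos hν hσ
  have hc := largeBallConst_pos hν hσ (1 / (4 * weightRatio C σ ^ 2))
  unfold deformedKernel
  set a := weightRatio C σ
  have ha0 : 0 < a := by linarith
  have hdh : 0 ≤ dist x y := dist_nonneg
  have hgd : γ (τ x.val) ≤ 4 * a ^ 2 * dist x y := by
    have h1 : τ x.val / (4 * a) ≤ min (dist x.val y.val) (τ x.val) := by
      refine le_min ?_ (div_le_self hx.le (by linarith))
      rwa [div_le_iff₀' (by positivity)]
    have h2 : ω (τ x.val) * (τ x.val / (4 * a)) ≤ a * dist x y := le_trans (by gcongr) hlow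
    rw [← mul_div_assoc, volumeWeight_mul_self ν b σ hx, div_le_iff₀ (by positivity)] at h2
    linarith
  have hgτ : γ (τ x.val) ^ σ * τ x.val ^ (-σ) = ω (τ x.val) ^ σ := by
    rw [← volumeWeight_mul_self ν b σ hx, Real.mul_rpow hwx.le hx.le, mul_assoc,
      ← Real.rpow_add hx]
    simp
  constructor
  · have h1 : (deformedVolume hν b m₀ hσ).real (ball x (dist x y)) ≤
        tailConst C σ * K ^ σ * τ x.val ^ (-σ) := by
      refine real_le_of_le_ofReal (by positivity) (deformedVolume_ball_le_of_forall x hx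
        (by linarith) fun z hz => ?_)
      -- A point z of the ball with Kτ(z) < τ(x) would have a gauge larger than
      -- `volumeGauge_le_of_mem_ball` allows; the decay factor was chosen for this contradiction.
      by_contra! hcon
      have h2 := hKd x.val z.val z.shiftedRadius_pos hcon.le
      have h3 := volumeGauge_le_of_mem_ball hz (by positivity) hgd
      have h4 : (2 * a + a * (4 * a ^ 2)) * dist x y ≤
          (2 * a + a * (4 * a ^ 2)) * (M * γ (τ x.val)) := by gcongr
      have : 0 < (2 * a + a * (4 * a ^ 2)) * (M * γ (τ x.val)) := by positivity
      have h5 : 2 * M * (2 * a + a * (4 * a ^ 2)) * γ (τ x.val) ≤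
        (2 * a + a * (4 * a ^ 2)) * dist x y := h2.trans h3
      linarith
    calc dist x y ^ σ * (deformedVolume hν b m₀ hσ).real (ball x (dist x y))
        ≤ (M * γ (τ x.val)) ^ σ * (tailConst C σ * K ^ σ * τ x.val ^ (-σ)) := by gcongr
      _ = M ^ σ * tailConst C σ * K ^ σ * (γ (τ x.val) ^ σ * τ x.val ^ (-σ)) := by
        rw [Real.mul_rpow (by positivity) hgx.le]
        ring
      _ = _ := by rw [hgτ]
  · have h1 := le_real_of_ofReal_le hfin (le_deformedVolume_ball_of_gauge_le x
      (l := 1 / (4 * a ^ 2)) (r := dist x y) (by positivity)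
      (by rwa [one_div_mul_eq_div, div_le_iff₀' (by positivity)]))
    calc ω (τ x.val) ^ σ = γ (τ x.val) ^ σ * τ x.val ^ (-σ) := hgτ.symm
      _ ≤ (4 * a ^ 2 * dist x y) ^ σ * τ x.val ^ (-σ) := by gcongr
      _ = (4 * a ^ 2) ^ σ * (largeBallConst C σ (1 / (4 * a ^ 2)))⁻¹ *
          (dist x y ^ σ * (largeBallConst C σ (1 / (4 * a ^ 2)) * τ x.val ^ (-σ))) := by
        rw [Real.mul_rpow (by positivity) hdh]
        field_simp
      _ ≤ _ := by gcongr

omit [BorelSpace Z] in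
theorem weightedKernel_nonneg (x y : DeformedSpace hν b m₀ hσ) : 0 ≤ weightedKernel x y := by
  have hwx := volumeWeight_pos (σ := σ) hν b x.shiftedRadius_pos
  have hwy := volumeWeight_pos (σ := σ) hν b y.shiftedRadius_pos
  unfold weightedKernel
  positivity

omit [BorelSpace Z] in
theorem deformedKernel_nonneg (x y : DeformedSpace hν b m₀ hσ) : 0 ≤ deformedKernel x y := by
  unfold deformedKernel
  positivity

omit [BorelSpace Z] in
theorem weightedKernel_swap {x y : DeformedSpace hν b m₀ hσ} (hxy : x ≠ y) :
    weightedKernel x y ≤ C * weightedKernel y x := by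
  have hwx := volumeWeight_pos (σ := σ) hν b x.shiftedRadius_pos
  have hwy := volumeWeight_pos (σ := σ) hν b y.shiftedRadius_pos
  have hd0 := Deformed.dist_val_pos hxy
  unfold weightedKernel
  rw [dist_comm y.val x.val, mul_comm (ω (τ y.val)), mul_left_comm (C : ℝ)]
  gcongr
  refine (hν.real_ball_mono (ball_subset_ball' ?_)).trans (hν.real_ball_two_mul y.val hd0)
  linarith

omit [BorelSpace Z] in
theorem deformedKernel_swap {A : ℝ≥0} (hA : IsDoublingWith (deformedVolume hν b m₀ hσ) A)
    {x y : DeformedSpace hν b m₀ hσ} (hxy : x ≠ y) :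
    deformedKernel x y ≤ A * deformedKernel y x := by
  have hd0 : 0 < dist x y := dist_pos.2 hxy
  unfold deformedKernel
  rw [dist_comm y x, mul_left_comm (A : ℝ)]
  gcongr
  refine (hA.real_ball_mono (ball_subset_ball' ?_)).trans (hA.real_ball_two_mul y hd0)
  linarith

/-- The comparison constant between the two kernels. -/
noncomputable def kernelConst (C A : ℝ≥0) (σ M K : ℝ) : ℝ :=
  C * A * (1 + (2 * weightRatio C σ ^ 2) ^ σ * growthFactor C (2 * weightRatio C σ) +
    (weightRatio C σ ^ 3) ^ σ * growthFactor C (weightRatio C σ * (1 + weightRatio C σ)) +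
    (M ^ σ * tailConst C σ * K ^ σ) * ((1 + 4 * weightRatio C σ) ^ σ *
      growthFactor C (1 + 2 * (4 * weightRatio C σ))) +
    (2 ^ σ * growthFactor C (2 * (1 + 4 * weightRatio C σ))) * ((4 * weightRatio C σ ^ 2) ^ σ *
        (largeBallConst C σ (1 / (4 * weightRatio C σ ^ 2)))⁻¹))

/-- Each kernel is symmetric up to its doubling constant, so τ(x) ≤ τ(y) may be assumed at the cost
of the factor C·A. In the far case ω(τ(x))^σ mediates. -/
theorem kernel_comparable {A : ℝ≥0} (hA : IsDoublingWith (deformedVolume hν b m₀ hσ) A)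
    {M K : ℝ} (hM : 1 ≤ M) (hbound : GaugeBound hν b m₀ hσ M) (hK : 2 ≤ K)
    (hKd : GaugeDecay ν b m₀ σ
      (2 * M * (2 * weightRatio C σ + weightRatio C σ * (4 * weightRatio C σ ^ 2))) K)
    {x y : DeformedSpace hν b m₀ hσ} (hxy : x ≠ y) :
    deformedKernel x y ≤ kernelConst C A σ M K * weightedKernel x y ∧
      weightedKernel x y ≤ kernelConst C A σ M K * deformedKernel x y := by
  have ha := two_le_weightRatio hν hσ
  have ht := tailConst_pos hν hσ
  have hc := largeBallConst_pos hν hσ (1 / (4 * weightRatio C σ ^ 2))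
  have hD1 := hν.growthFactor_pos (2 * weightRatio C σ)
  have hD2 := hν.growthFactor_pos (weightRatio C σ * (1 + weightRatio C σ))
  have hD3 := hν.growthFactor_pos (1 + 2 * (4 * weightRatio C σ))
  have hD4 := hν.growthFactor_pos (2 * (1 + 4 * weightRatio C σ))
  have hC1 : (1 : ℝ) ≤ C := by exact_mod_cast hν.one_lt.le
  have hA1 : (1 : ℝ) ≤ A := by exact_mod_cast hA.one_lt.le
  unfold kernelConst
  set E₁ := (2 * weightRatio C σ ^ 2) ^ σ * growthFactor C (2 * weightRatio C σ)
  set E₂ := (weightRatio C σ ^ 3) ^ σ * growthFactor C (weightRatio C σ * (1 + weightRatio C σ))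
  set F₁ := M ^ σ * tailConst C σ * K ^ σ
  set F₂ := (1 + 4 * weightRatio C σ) ^ σ * growthFactor C (1 + 2 * (4 * weightRatio C σ))
  set G₁ := 2 ^ σ * growthFactor C (2 * (1 + 4 * weightRatio C σ))
  set G₂ := (4 * weightRatio C σ ^ 2) ^ σ *
        (largeBallConst C σ (1 / (4 * weightRatio C σ ^ 2)))⁻¹
  have hE₁ : 0 < E₁ := by positivity
  have hE₂ : 0 < E₂ := by positivity
  have hF₁ : 0 < F₁ := by positivity
  have hF₂ : 0 < F₂ := by positivity
  have hG₁ : 0 < G₁ := by positivity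
  have hG₂ : 0 < G₂ := by positivity
  have hFF : 0 < F₁ * F₂ := by positivity
  have hGG : 0 < G₁ * G₂ := by positivity
  set B := 1 + E₁ + E₂ + F₁ * F₂ + G₁ * G₂ with hB
  have hordered : ∀ x y : DeformedSpace hν b m₀ hσ, x ≠ y → τ x.val ≤ τ y.val →
      deformedKernel x y ≤ B * weightedKernel x y ∧
        weightedKernel x y ≤ B * deformedKernel x y := by
    intro x y hxy hle
    have hfin := (hA.measure_ball_lt_top x (dist x y)).ne
    have hw := weightedKernel_nonneg x y
    have hd := deformedKernel_nonneg x y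
    rcases le_or_gt (dist x.val y.val) (τ x.val / (4 * weightRatio C σ)) with h | h
    · obtain ⟨h1, h2⟩ := deformedKernel_near hxy hle h hfin
      refine ⟨h1.trans ?_, h2.trans ?_⟩ <;> gcongr <;> linarith
    · rw [div_lt_iff₀' (by positivity)] at h
      obtain ⟨h1, h2⟩ := deformedKernel_far hle h.le hfin hM hbound hK hKd
      obtain ⟨h3, h4⟩ := weightedKernel_far hle (by positivity) h.le
      constructor
      · calc deformedKernel x y ≤ F₁ * (F₂ * weightedKernel x y) := h1.trans (by gcongr)
          _ = F₁ * F₂ * weightedKernel x y := by ring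
          _ ≤ _ := by gcongr; linarith
      · calc weightedKernel x y ≤ G₁ * (G₂ * deformedKernel x y) := h3.trans (by gcongr)
          _ = G₁ * G₂ * deformedKernel x y := by ring
          _ ≤ _ := by gcongr; linarith
  have hB0 : 0 < B := by linarith
  have hw := weightedKernel_nonneg x y
  have hd := deformedKernel_nonneg x y
  rcases le_total (τ x.val) (τ y.val) with h | h
  · obtain ⟨h1, h2⟩ := hordered x y hxy h
    have hCA : B ≤ C * A * B := by
      have : 1 ≤ (C : ℝ) * A := one_le_mul_of_one_le_of_one_le hC1 hA1
      nlinarith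
    exact ⟨h1.trans (by gcongr), h2.trans (by gcongr)⟩
  · obtain ⟨h1, h2⟩ := hordered y x hxy.symm h
    constructor
    · calc deformedKernel x y ≤ A * (B * (C * weightedKernel x y)) :=
          (deformedKernel_swap hA hxy).trans (by
            gcongr
            exact h1.trans (by gcongr; exact weightedKernel_swap hxy.symm))
        _ = _ := by ring
    · calc weightedKernel x y ≤ C * (B * (A * deformedKernel x y)) :=
          (weightedKernel_swap hxy).trans (by
            gcongr
            exact h2.trans (by gcongr; exact deformedKernel_swap hA hxy.symm))
        _ = _ := by ring

end Kernel

/-! ### Doubling measures under completion; double integrals off the diagonal. -/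

section General

theorem IsDoublingWith.mono {X : Type*} [PseudoMetricSpace X] [MeasurableSpace X]
    {μ : Measure X} {C C' : ℝ≥0} (hμ : IsDoublingWith μ C) (h : C ≤ C') :
    IsDoublingWith μ C' where
  one_lt := hμ.one_lt.trans_le h
  pos := hμ.pos
  doubling x r hr := (hμ.doubling x r hr).trans (by gcongr)
  finite := hμ.finite

/-- The doubling property extends along isometries with dense range. -/
theorem IsDoublingWith.map_isometry {X Y : Type*} [PseudoMetricSpace X] [MeasurableSpace X]
    [PseudoMetricSpace Y] [MeasurableSpace Y] [OpensMeasurableSpace Y]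
    {μ : Measure X} {C : ℝ≥0} (hμ : IsDoublingWith μ C) {f : X → Y} (hf : Isometry f)
    (hfm : Measurable f) (hd : DenseRange f) : IsDoublingWith (μ.map f) (C ^ 2) := by
  have hC : 0 < C := lt_trans zero_lt_one hμ.one_lt
  -- A center x with f(x) within r/4 of y sandwiches the preimages between radii 3r/4 and 3r, two
  -- doublings apart; hence C².
  have near : ∀ (y : Y) (r : ℝ), 0 < r → ∃ x : X, ball x (3 / 4 * r) ⊆ f ⁻¹' ball y r ∧
      f ⁻¹' ball y (2 * r) ⊆ ball x (2 * (2 * (3 / 4 * r))) := by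
    intro y r hr
    obtain ⟨x, hx⟩ := hd.exists_dist_lt y (show 0 < r / 4 by positivity)
    refine ⟨x, fun z hz => ?_, fun z hz => ?_⟩
    · rw [mem_ball, ← hf.dist_eq] at hz
      rw [Set.mem_preimage, mem_ball]
      linarith [dist_triangle_right (f z) y (f x)]
    · rw [Set.mem_preimage, mem_ball] at hz
      rw [mem_ball, ← hf.dist_eq]
      rw [dist_comm] at hx
      linarith [dist_triangle_right (f z) (f x) y, dist_comm (f x) y]
  refine ⟨one_lt_pow₀ hμ.one_lt two_ne_zero, fun y r hr => ?_, fun y r hr => ?_,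
    fun y r hr => ?_⟩
  · obtain ⟨x, hx, _⟩ := near y (2 * r) (by positivity)
    rw [Measure.map_apply hfm measurableSet_ball]
    exact (hμ.measure_ball_pos x (by positivity)).trans_le (measure_mono hx)
  · obtain ⟨x, hx1, hx2⟩ := near y r hr
    rw [Measure.map_apply hfm measurableSet_ball, Measure.map_apply hfm measurableSet_ball]
    calc μ (f ⁻¹' ball y (2 * r)) ≤ μ (ball x (2 * (2 * (3 / 4 * r)))) := measure_mono hx2
      _ ≤ C * (C * μ (ball x (3 / 4 * r))) :=
        (hμ.doubling _ _ (by positivity)).trans (by gcongr; exact hμ.doubling _ _ (by positivity))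
      _ ≤ C * (C * μ (f ⁻¹' ball y r)) := by gcongr
      _ = _ := by push_cast; ring
  · obtain ⟨x, _, hx⟩ := near y r hr
    rw [Measure.map_apply hfm measurableSet_ball]
    exact (measure_mono ((Set.preimage_mono (ball_subset_ball (by linarith))).trans hx)).trans_lt
      (hμ.measure_ball_lt_top _ _)

theorem IsDoublingWith.sigmaFinite {X : Type*} [PseudoMetricSpace X] [Nonempty X]
    [MeasurableSpace X] {μ : Measure X} {C : ℝ≥0} (hμ : IsDoublingWith μ C) : SigmaFinite μ := by
  obtain ⟨b⟩ := ‹Nonempty X›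
  exact ⟨⟨⟨fun n => ball b (n + 1), fun _ => trivial, fun n => hμ.measure_ball_lt_top b _,
    iUnion_ball_nat_succ b⟩⟩⟩

/-- A disjoint family of balls of positive measure is countable by σ-finiteness, and by the Vitali
covering lemma its centers can be taken ε-dense. -/
theorem IsDoublingWith.secondCountableTopology {X : Type*} [PseudoMetricSpace X] [Nonempty X]
    [MeasurableSpace X] [OpensMeasurableSpace X] {μ : Measure X} {C : ℝ≥0}
    (hμ : IsDoublingWith μ C) : SecondCountableTopology X := by
  have := hμ.sigmaFinite
  refine Metric.secondCountable_of_almost_dense_set fun ε hε => ?_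
  obtain ⟨u, -, hu, hcov⟩ := Vitali.exists_disjoint_subfamily_covering_enlargement_closedBall
    (Set.univ : Set X) id (fun _ => ε / 4) (ε / 4) (fun _ _ => le_rfl) 4 (by norm_num)
  refine ⟨u, ?_, fun x => ?_⟩
  · have h := Measure.countable_meas_pos_of_disjoint_iUnion (μ := μ)
      (As := fun x : u => ball (x : X) (ε / 4)) (fun _ => measurableSet_ball)
      (fun x y hxy => (hu x.2 y.2 (Subtype.coe_ne_coe.2 hxy)).mono ball_subset_closedBall
        ball_subset_closedBall)
    have hall : {x : u | 0 < μ (ball (x : X) (ε / 4))} = Set.univ :=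
      Set.eq_univ_of_forall fun x => hμ.measure_ball_pos _ (by positivity)
    rw [hall, Set.countable_univ_iff] at h
    exact h
  · obtain ⟨y, hy, hxy⟩ := hcov x (Set.mem_univ x)
    refine ⟨y, hy, ?_⟩
    have := hxy (mem_closedBall_self (by positivity))
    simpa [mem_closedBall, mul_div_cancel₀] using this

theorem MeasurableEmbedding.lintegral_lintegral_compl_map {X Y : Type*} [MeasurableSpace X]
    [MeasurableSpace Y] {f : X → Y} (hf : MeasurableEmbedding f) (μ : Measure X)
    (F : Y → Y → ℝ≥0∞) :
    ∫⁻ x, ∫⁻ y in {x}ᶜ, F x y ∂(μ.map f) ∂(μ.map f) =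
      ∫⁻ x, ∫⁻ y in {x}ᶜ, F (f x) (f y) ∂μ ∂μ := by
  rw [hf.lintegral_map]
  refine lintegral_congr fun x => ?_
  rw [hf.restrict_map, hf.lintegral_map]
  congr 2
  ext y
  simp [hf.injective.eq_iff]

theorem besovEnergy_map {X Y : Type*} [MetricSpace X] [MeasurableSpace X]
    [MetricSpace Y] [MeasurableSpace Y] [OpensMeasurableSpace Y] {f : X → Y} (hf : Isometry f)
    (hfm : MeasurableEmbedding f) (μ : Measure X) (θ p : ℝ) (u : Y → EReal) :
    besovEnergy (μ.map f) θ p u = besovEnergy μ θ p (u ∘ f) := by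
  unfold besovEnergy
  rw [hfm.lintegral_lintegral_compl_map μ (fun x y => (u x - u y).abs ^ p /
    (edist x y ^ (θ * p) * μ.map f (ball x (dist x y))))]
  simp only [Measure.map_apply hfm.measurable measurableSet_ball, hf.edist_eq, hf.dist_eq,
    hf.preimage_ball, Function.comp]

/-- No measurability of F is needed, because the weight is measurable and finite everywhere. -/
theorem lintegral_lintegral_compl_withDensity {X : Type*} [MeasurableSpace X]
    [MeasurableSingletonClass X] (μ : Measure X) {w : X → ℝ≥0∞} (hw : Measurable w)
    (hw' : ∀ x, w x ≠ ⊤) (F : X → X → ℝ≥0∞) :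
    ∫⁻ x, ∫⁻ y in {x}ᶜ, F x y ∂(μ.withDensity w) ∂(μ.withDensity w) =
      ∫⁻ x, ∫⁻ y in {x}ᶜ, w x * (w y * F x y) ∂μ ∂μ := by
  rw [lintegral_withDensity_eq_lintegral_mul_non_measurable _ hw
    (Filter.Eventually.of_forall fun x => (hw' x).lt_top)]
  refine lintegral_congr fun x => ?_
  rw [Pi.mul_apply, setLIntegral_withDensity_eq_setLIntegral_mul_non_measurable _ hw _
    (measurableSet_singleton x).compl (Filter.Eventually.of_forall fun x => (hw' x).lt_top),
    lintegral_const_mul' _ _ (hw' x)]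
  rfl

theorem lintegral_lintegral_compl_le {X : Type*} [MeasurableSpace X]
    [MeasurableSingletonClass X] (μ : Measure X) {A : ℝ≥0∞} (hA : A ≠ ⊤) {F G : X → X → ℝ≥0∞}
    (h : ∀ x y, x ≠ y → F x y ≤ A * G x y) :
    ∫⁻ x, ∫⁻ y in {x}ᶜ, F x y ∂μ ∂μ ≤ A * ∫⁻ x, ∫⁻ y in {x}ᶜ, G x y ∂μ ∂μ := by
  rw [← lintegral_const_mul' _ _ hA]
  refine lintegral_mono fun x => ?_
  rw [← lintegral_const_mul' _ _ hA]
  exact setLIntegral_mono' (measurableSet_singleton x).compl fun y hy => h x y (Ne.symm hy)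

end General

/-! ### Comparison of the energies. -/

section Energy

variable {Z : Type*} [MetricSpace Z] [MeasurableSpace Z] [BorelSpace Z]
  {ν : Measure Z} {C : ℝ≥0} {hν : IsDoublingWith ν C} {b : Z} {m₀ : ℝ≥0} {σ κ : ℝ}
  {hσ : 0 < σ}

local notation "τ" => shiftedRadius b m₀
local notation "γ" => volumeGauge ν b σ
local notation "ω" => volumeWeight ν b σ

/-- The deformed space is homeomorphic to an open subset of the Polish space Z. Its Borel images in
the completion are then Borel by Lusin–Souslin, so integrals transfer without any measurability of
the integrand. -/
theorem Deformed.polishSpace [CompleteSpace Z] [Nonempty Z] :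
    PolishSpace (DeformedSpace hν b m₀ hσ) := by
  have := hν.secondCountableTopology
  have h := Deformed.isOpenEmbedding_val (hν := hν) (b := b) (m₀ := m₀) (hσ := hσ)
  have := h.isOpen_range.polishSpace
  exact h.isEmbedding.toHomeomorph.isClosedEmbedding.polishSpace

theorem Deformed.measurableEmbedding_coe [CompleteSpace Z] [Nonempty Z] :
    MeasurableEmbedding (fun x : DeformedSpace hν b m₀ hσ =>
      (x : DeformedCompletion (specialDensity hν b m₀ hσ) b)) := by
  have := Deformed.polishSpace (hν := hν) (b := b) (m₀ := m₀) (hσ := hσ)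
  exact (UniformSpace.Completion.continuous_coe _).measurableEmbedding
    (UniformSpace.Completion.coe_injective _)

omit [BorelSpace Z] in
-- An atom at b would bound γ by ν({b})^{-1/σ}, whereas uniform perfectness supplies points
-- approaching b along which gauge decay makes γ unbounded.
theorem measure_singleton_basepoint [Nontrivial Z] (hb : UniformlyPerfectAt b (0 : ℝ≥0) κ)
    (hν : IsDoublingWith ν C) (hσ : 0 < σ)
    (hdecay : ∀ q > 0, ∃ K, 2 ≤ K ∧ GaugeDecay ν b 0 σ q K) : ν {b} = 0 := by
  by_contra h0
  have hκ := hb.one_lt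
  have hfin : ν {b} ≠ ⊤ := ((measure_mono (Set.singleton_subset_iff.2
    (mem_ball_self one_pos))).trans_lt (hν.measure_ball_lt_top b 1)).ne
  have hpos : 0 < ν.real {b} := ENNReal.toReal_pos h0 hfin
  obtain ⟨x, hx⟩ := exists_ne b
  have hxb : 0 < dist x b := dist_pos.2 hx
  have hτ : ∀ z : Z, shiftedRadius b 0 z = dist z b := fun z => by simp [shiftedRadius]
  have hg := volumeGauge_pos (σ := σ) hν b hxb
  have hB : 0 < ν.real {b} ^ (-(1 / σ)) := Real.rpow_pos_of_pos hpos _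
  obtain ⟨K, hK, hKd⟩ := hdecay (2 * ν.real {b} ^ (-(1 / σ)) / volumeGauge ν b σ (dist x b))
    (by positivity)
  have hr : dist x b / (κ * K) ≤ dist x b := div_le_self hxb.le (by nlinarith)
  obtain ⟨y, hy1, hy2⟩ := hb.exists_mem (r := dist x b / (κ * K)) (by positivity)
    (by simp; positivity) hr
  have hyb : 0 < dist y b := lt_of_lt_of_le (by positivity) hy1
  have e : κ * (dist x b / (κ * K)) = dist x b / K := by field_simp
  rw [e, lt_div_iff₀' (by positivity)] at hy2
  have h1 := hKd x y (by rwa [hτ]) (by rw [hτ, hτ]; exact hy2.le)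
  rw [hτ, hτ, div_mul_cancel₀ _ hg.ne'] at h1
  have h2 : volumeGauge ν b σ (dist y b) ≤ ν.real {b} ^ (-(1 / σ)) :=
    Real.rpow_le_rpow_of_nonpos hpos (measureReal_mono (Set.singleton_subset_iff.2
      (mem_ball_self hyb)) (hν.measure_ball_lt_top _ _).ne)
      (by have := one_div_pos.2 hσ; linarith)
  linarith

theorem map_comap_val [Nontrivial Z] (hb : UniformlyPerfectAt b m₀ κ)
    (hdecay : ∀ q > 0, ∃ K, 2 ≤ K ∧ GaugeDecay ν b m₀ σ q K) :
    (ν.comap (Deformed.val : DeformedSpace hν b m₀ hσ → Z)).map Deformed.val = ν := by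
  rw [Deformed.measurableEmbedding_val.map_comap]
  refine Measure.restrict_eq_self_of_ae_mem (mem_ae_iff.2 ?_)
  rcases eq_or_ne m₀ 0 with rfl | hm
  · refine measure_mono_null (fun z hz => ?_) (measure_singleton_basepoint hb hν hσ hdecay)
    by_contra hzb
    refine hz ?_
    have : 0 < shiftedRadius b 0 z := by simpa [shiftedRadius] using hzb
    obtain ⟨x, hx⟩ := Deformed.exists_val_eq (hν := hν) (hσ := hσ) this
    exact ⟨x, hx⟩
  · have : ∀ z : Z, z ∈ Set.range (Deformed.val : DeformedSpace hν b m₀ hσ → Z) := fun z => by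
      have hm' : (0 : ℝ) < m₀ := by exact_mod_cast pos_iff_ne_zero.2 hm
      obtain ⟨x, hx⟩ := Deformed.exists_val_eq (hν := hν) (hσ := hσ) (b := b) (m₀ := m₀)
        (z := z) (by unfold shiftedRadius; positivity)
      exact ⟨x, hx⟩
    exact measure_mono_null (fun z hz => hz (this z)) measure_empty

theorem edist_rpow_mul_measure_ball {X : Type*} [MetricSpace X] [MeasurableSpace X]
    {μ : Measure X} {A : ℝ≥0} (hμ : IsDoublingWith μ A) (hσ : 0 < σ) (x y : X) :
    edist x y ^ σ * μ (ball x (dist x y)) =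
      ENNReal.ofReal (dist x y ^ σ * μ.real (ball x (dist x y))) := by
  rw [ENNReal.ofReal_mul (by positivity), ← ENNReal.ofReal_rpow_of_nonneg dist_nonneg hσ.le,
    ← edist_dist, Measure.real, ENNReal.ofReal_toReal (hμ.measure_ball_lt_top _ _).ne]

/-- Both energies become double integrals over the deformed space against ν. As θp = σ, they have
the same numerator, and after moving the densities ρ^σ across, the denominators are the two kernels.
-/
theorem energy_comparable [CompleteSpace Z] [Nontrivial Z] (hb : UniformlyPerfectAt b m₀ κ)
    (hdecay : ∀ q > 0, ∃ K, 2 ≤ K ∧ GaugeDecay ν b m₀ σ q K)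
    {A B : ℝ≥0} (hA : IsDoublingWith (deformedVolume hν b m₀ hσ) A)
    (hB : ∀ x y : DeformedSpace hν b m₀ hσ, x ≠ y →
      deformedKernel x y ≤ B * weightedKernel x y ∧ weightedKernel x y ≤ B * deformedKernel x y)
    {p θ : ℝ} (hpθ : σ = p * θ) (u : Z → EReal)
    (v : DeformedCompletion (specialDensity hν b m₀ hσ) b → EReal)
    (huv : ∀ x : DeformedSpace hν b m₀ hσ, v x = u x.val) :
    besovEnergy ν θ p u ≤
        B * besovEnergy (deformedMeasureCompletion ν (specialDensity hν b m₀ hσ) b σ) θ p v ∧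
      besovEnergy (deformedMeasureCompletion ν (specialDensity hν b m₀ hσ) b σ) θ p v ≤
        B * besovEnergy ν θ p u := by
  have hθp : θ * p = σ := by rw [hpθ, mul_comm]
  have hcompl : besovEnergy (deformedMeasureCompletion ν (specialDensity hν b m₀ hσ) b σ) θ p v =
      besovEnergy (deformedVolume hν b m₀ hσ) θ p (fun x => u x.val) := by
    unfold deformedMeasureCompletion
    rw [besovEnergy_map UniformSpace.Completion.coe_isometry Deformed.measurableEmbedding_coe]
    congr 1
    funext x
    exact huv x
  have hval : besovEnergy ν θ p u = ∫⁻ x : DeformedSpace hν b m₀ hσ, ∫⁻ y in {x}ᶜ,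
      (u x.val - u y.val).abs ^ p / (edist x.val y.val ^ (θ * p) *
        ν (ball x.val (dist x.val y.val))) ∂(ν.comap Deformed.val) ∂(ν.comap Deformed.val) := by
    rw [← Deformed.measurableEmbedding_val.lintegral_lintegral_compl_map
      (ν.comap (Deformed.val : DeformedSpace hν b m₀ hσ → Z)) (fun x y =>
      (u x - u y).abs ^ p / (edist x y ^ (θ * p) * ν (ball x (dist x y)))),
      map_comap_val hb hdecay]
    rfl
  have hwm : Measurable fun x : DeformedSpace hν b m₀ hσ =>
      specialDensity hν b m₀ hσ (nndist x.val b) ^ σ := by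
    have h1 : Measurable (specialDensity hν b m₀ hσ : ℝ≥0 → ℝ≥0∞) :=
      (specialDensity hν b m₀ hσ).antitone.measurable
    have h2 : Measurable fun x : DeformedSpace hν b m₀ hσ => nndist x.val b :=
      (Deformed.continuous_val.nndist continuous_const).measurable
    exact (h1.comp h2).pow_const σ
  have hdef : besovEnergy (deformedVolume hν b m₀ hσ) θ p (fun x => u x.val) =
      ∫⁻ x : DeformedSpace hν b m₀ hσ, ∫⁻ y in {x}ᶜ,
        specialDensity hν b m₀ hσ (nndist x.val b) ^ σ *
        (specialDensity hν b m₀ hσ (nndist y.val b) ^ σ * ((u x.val - u y.val).abs ^ p /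
          (edist x y ^ (θ * p) * deformedVolume hν b m₀ hσ (ball x (dist x y)))))
        ∂(ν.comap Deformed.val) ∂(ν.comap Deformed.val) :=
    lintegral_lintegral_compl_withDensity _ hwm
      (fun x => ENNReal.rpow_ne_top_of_nonneg hσ.le x.density_lt_top.ne) _
  rw [hcompl, hval, hdef, hθp]
  have key : ∀ x y : DeformedSpace hν b m₀ hσ, x ≠ y →
      (u x.val - u y.val).abs ^ p / (edist x.val y.val ^ σ *
          ν (ball x.val (dist x.val y.val))) ≤
        B * (specialDensity hν b m₀ hσ (nndist x.val b) ^ σ *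
        (specialDensity hν b m₀ hσ (nndist y.val b) ^ σ * ((u x.val - u y.val).abs ^ p /
          (edist x y ^ σ * deformedVolume hν b m₀ hσ (ball x (dist x y)))))) ∧
      specialDensity hν b m₀ hσ (nndist x.val b) ^ σ *
        (specialDensity hν b m₀ hσ (nndist y.val b) ^ σ * ((u x.val - u y.val).abs ^ p /
          (edist x y ^ σ * deformedVolume hν b m₀ hσ (ball x (dist x y))))) ≤
        B * ((u x.val - u y.val).abs ^ p / (edist x.val y.val ^ σ *
          ν (ball x.val (dist x.val y.val)))) := by
    intro x y hxy
    obtain ⟨h1, h2⟩ := hB x y hxy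
    have hwx := volumeWeight_pos (σ := σ) hν b x.shiftedRadius_pos
    have hwy := volumeWeight_pos (σ := σ) hν b y.shiftedRadius_pos
    have hd0 := Deformed.dist_val_pos hxy
    have hdh : 0 < dist x y := dist_pos.2 hxy
    have hV := hν.real_ball_pos x.val hd0
    have hVh := hA.real_ball_pos x hdh
    rw [edist_rpow_mul_measure_ball hν hσ, edist_rpow_mul_measure_ball hA hσ,
      specialDensity_rpow, specialDensity_rpow, div_eq_mul_inv, div_eq_mul_inv,
      ← ENNReal.ofReal_inv_of_pos (by positivity), ← ENNReal.ofReal_inv_of_pos (by positivity),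
      ← ENNReal.ofReal_coe_nnreal]
    have e1 : weightedKernel x y = ω (τ x.val) ^ σ * ω (τ y.val) ^ σ *
        (dist x.val y.val ^ σ * ν.real (ball x.val (dist x.val y.val))) := by
      unfold weightedKernel
      rw [Real.mul_rpow (by positivity) (by positivity), Real.mul_rpow (by positivity)
        (by positivity)]
      ring
    change dist x y ^ σ * (deformedVolume hν b m₀ hσ).real (ball x (dist x y)) ≤ _ at h1
    change _ ≤ (B : ℝ) * (dist x y ^ σ * (deformedVolume hν b m₀ hσ).real (ball x (dist x y))) at h2
    rw [e1] at h1 h2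
    have hX : 0 < ω (τ x.val) ^ σ := by positivity
    have hY : 0 < ω (τ y.val) ^ σ := by positivity
    have hD : 0 < dist x.val y.val ^ σ * ν.real (ball x.val (dist x.val y.val)) := by positivity
    have hE : 0 < dist x y ^ σ * (deformedVolume hν b m₀ hσ).real (ball x (dist x y)) := by
      positivity
    generalize ω (τ x.val) ^ σ = X at *
    generalize ω (τ y.val) ^ σ = Y at *
    generalize dist x.val y.val ^ σ * ν.real (ball x.val (dist x.val y.val)) = D at *
    generalize dist x y ^ σ * (deformedVolume hν b m₀ hσ).real (ball x (dist x y)) = E at *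
    generalize (u x.val - u y.val).abs ^ p = N
    have hB0 : (0 : ℝ) ≤ B := B.2
    have e2 : ENNReal.ofReal X * (ENNReal.ofReal Y * (N * ENNReal.ofReal E⁻¹)) =
        N * ENNReal.ofReal (X * Y * E⁻¹) := by
      rw [ENNReal.ofReal_mul (by positivity), ENNReal.ofReal_mul hX.le]
      ring
    rw [e2, mul_left_comm, mul_left_comm (ENNReal.ofReal (B : ℝ)) N,
      ← ENNReal.ofReal_mul hB0, ← ENNReal.ofReal_mul hB0]
    constructor
    · refine mul_le_mul_right (ENNReal.ofReal_le_ofReal ?_) N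
      rw [← mul_assoc, ← div_eq_mul_inv, inv_eq_one_div, div_le_div_iff₀ hD hE]
      linarith
    · refine mul_le_mul_right (ENNReal.ofReal_le_ofReal ?_) N
      rw [← div_eq_mul_inv, ← div_eq_mul_inv, div_le_div_iff₀ hE hD]
      exact h2
  exact ⟨lintegral_lintegral_compl_le _ ENNReal.coe_ne_top fun x y hxy => (key x y hxy).1,
    lintegral_lintegral_compl_le _ ENNReal.coe_ne_top fun x y hxy => (key x y hxy).2⟩

end Energy

/-! ### Choice of constants and conclusion. -/

theorem theorem1p1 (Cν : ℝ≥0) (κ σ : ℝ) (hσ : 0 < σ) :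
    ∃ C A : ℝ≥0, ∀ (Z : Type*) [MetricSpace Z] [CompleteSpace Z] [Nontrivial Z]
      [MeasurableSpace Z] [BorelSpace Z] (ν : Measure Z) (b : Z) (m₀ : ℝ≥0)
      (hν : IsDoublingWith ν Cν), (m₀ = 0 ∨ m₀ = 1) → UniformlyPerfectAt b m₀ κ →
      (IsDoublingWith (deformedMeasure ν (specialDensity hν b m₀ hσ) b σ) C ∧
        IsDoublingWith (deformedMeasureCompletion ν (specialDensity hν b m₀ hσ) b σ) C) ∧
      ∀ p θ : ℝ, 1 ≤ p → 0 < θ → σ = p * θ →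
        ∀ u : Z → EReal, AEMeasurable u ν → (∀ᵐ x ∂ν, u x ≠ ⊤ ∧ u x ≠ ⊥) →
        ∀ v : DeformedCompletion (specialDensity hν b m₀ hσ) b → EReal,
          (∀ x : Deformed (specialDensity hν b m₀ hσ) b, v x = u x.val) →
          besovEnergy ν θ p u ≤
              A * besovEnergy (deformedMeasureCompletion ν (specialDensity hν b m₀ hσ) b σ) θ p v ∧
            besovEnergy (deformedMeasureCompletion ν (specialDensity hν b m₀ hσ) b σ) θ p v ≤
              A * besovEnergy ν θ p u := by

  -- If either constant is at most 1, no space satisfies the hypotheses and any C and A serve.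
  by_cases hpar : 1 < Cν ∧ 1 < κ
  swap
  · exact ⟨0, 0, fun Z _ _ _ _ _ ν b m₀ hν _ hb => absurd ⟨hν.one_lt, hb.one_lt⟩ hpar⟩
  obtain ⟨hC, hκ⟩ := hpar
  have hgd := fun (q : ℝ) (hq : 0 < q) => exists_gaugeDecay Cν κ hσ hκ hC hq
  choose K hK2 hKd using hgd
  have ha : 0 < weightRatio Cν σ := by
    have : 0 < Cν := lt_trans zero_lt_one hC
    unfold weightRatio
    positivity
  -- The choices are not circular: halving the gauge fixes M, and M fixes the decay factors for
  -- doubling and for the kernels. None involves the space, m₀, p or θ except through σ.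
  set M := 4 * (2 + κ * K 2 two_pos) with hM
  have hM1 : 1 ≤ M := by
    have := hK2 2 two_pos
    have : 0 < κ * K 2 two_pos := by positivity
    linarith
  have hM0 : 0 < M := by linarith
  have hq₁ : 0 < 2 * M *
      ((2 * weightRatio Cν σ + weightRatio Cν σ * (2 * weightRatio Cν σ)) * 2) := by
    positivity
  have hq₂ : 0 < 2 * M *
      (2 * weightRatio Cν σ + weightRatio Cν σ * (4 * weightRatio Cν σ ^ 2)) := by
    positivity
  set A := (deformedDoublingConst Cν σ κ (K _ hq₁)).toNNReal with hA
  set B := (kernelConst Cν A σ M (K _ hq₂)).toNNReal with hB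
  refine ⟨A ^ 2, B, fun Z _ _ _ _ _ ν b m₀ hν _ hb => ?_⟩
  have hdecay : ∀ q > 0, ∃ K, 2 ≤ K ∧ GaugeDecay ν b m₀ σ q K :=
    fun q hq => ⟨K q hq, hK2 q hq, hKd q hq Z ν b m₀ hν hb⟩
  have hbound : GaugeBound hν b m₀ hσ M := fun x y h =>
    Deformed.dist_le_gauge hb (hK2 2 two_pos) (hKd 2 two_pos Z ν b m₀ hν hb) x y h
  have hdbl : IsDoublingWith (deformedVolume hν b m₀ hσ) A :=
    isDoublingWith_deformedVolume hb hdecay hM1 hbound (hK2 _ hq₁) (hKd _ hq₁ Z ν b m₀ hν hb)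
  refine ⟨⟨hdbl.mono (le_self_pow₀ hdbl.one_lt.le two_ne_zero),
    hdbl.map_isometry UniformSpace.Completion.coe_isometry
      (UniformSpace.Completion.continuous_coe _).measurable
      UniformSpace.Completion.denseRange_coe⟩, fun p θ _ _ hpθ u _ _ v huv => ?_⟩
  refine energy_comparable hb hdecay hdbl (fun x y hxy => ?_) hpθ u v huv
  obtain ⟨h1, h2⟩ := kernel_comparable hdbl hM1 hbound (hK2 _ hq₂)
    (hKd _ hq₂ Z ν b m₀ hν hb) hxy
  exact ⟨h1.trans (mul_le_mul_of_nonneg_right (Real.le_coe_toNNReal _) (weightedKernel_nonneg x y)),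
    h2.trans (mul_le_mul_of_nonneg_right (Real.le_coe_toNNReal _) (deformedKernel_nonneg x y))⟩
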